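/- Let $L>0$, let $c\in\mathbb R$ satisfy $1-c^2>0$, put $\alpha=1-c^2$, and let $\nu>\frac{2\pi^2}{L^2}$. Let $K(k)=\int_0^{\pi/2}\frac{dt}{\sqrt{1-k^2\sin^2t}}$ denote the complete elliptic integral of the first kind and $\mathrm{dn}(\cdot\,;k)$ the Jacobi elliptic function of dnoidal type. Let $\eta_2=\eta_2(\nu)$ be the unique number in $(0,\sqrt{\nu\alpha})$ such that, with $$\eta_1=\sqrt{2\nu\alpha-\eta_2^2},\qquad k=\sqrt{\frac{\eta_1^2-\eta_2^2}{\eta_1^2}},$$ one has $\frac{2\sqrt{2\alpha}}{\eta_1}K(k)=L$, and let $$\phi_\nu(\xi)=\eta_1\,\mathrm{dn}\Big(\tfrac{\eta_1\xi}{\sqrt{2(1-c^2)}};k\Big),\qquad \psi_\nu(\xi)=-\frac{\eta_1^2}{1-c^2}\,\mathrm{dn}^2\Big(\tfrac{\eta_1\xi}{\sqrt{2(1-c^2)}};k\Big)$$ be the corresponding dnoidal waves, which are $L$-periodic. Let $\mathcal L_3=-\frac{d^2}{dx^2}+\nu+3\psi_\nu$ and, for a complex-valued $f$ in the periodic Sobolev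 space $H^1_{per}([0,L])$ with weak derivative $f'$, let $$(\mathcal L_3f,f)=\int_0^L\big(|f'|^2+(\nu+3\psi_\nu)|f|^2\big)\,dx$$ denote its quadratic form. Let $(f,g)=\int_0^L f\bar g\,dx$ and $\|f\|^2=(f,f)$. Then (a) $\inf\{(\mathcal L_3f,f): f\in H^1_{per}([0,L]),\ \|f\|=1,\ (f,\phi_\nu)=0\}=0$; (b) $\inf\{(\mathcal L_3f,f): f\in H^1_{per}([0,L]),\ \|f\|=1,\ (f,\phi_\nu)=0,\ (f,(\phi_\nu\psi_\nu)')=0\}>0$. -/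

import Mathlib

open MeasureTheory
open scoped ContDiff

noncomputable section

namespace Zakharov

/-- The incomplete elliptic integral of the first kind
`F(x; k) = ∫₀ˣ dt / √(1 - k² sin² t)` of modulus `k`. -/
def ellipticF (k x : ℝ) : ℝ :=
  ∫ t in (0 : ℝ)..x, 1 / √(1 - k ^ 2 * Real.sin t ^ 2)

/-- The complete elliptic integral of the first kind `K(k) = F(π/2; k)`. -/
def ellipticK (k : ℝ) : ℝ := ellipticF k (Real.pi / 2)

/-- The Jacobi amplitude `am(u; k)`: the inverse function of `x ↦ F(x; k)`, which is a bijection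
of `ℝ` when `0 ≤ k < 1`. -/
def jacobiAm (k u : ℝ) : ℝ := Function.invFun (ellipticF k) u

/-- The Jacobi elliptic function `dn(u; k) = √(1 - k² sn²(u; k))`, `sn = sin ∘ am`
(for `0 ≤ k < 1`). -/
def jacobiDn (k u : ℝ) : ℝ := √(1 - k ^ 2 * Real.sin (jacobiAm k u) ^ 2)

/-- `η₁` as a function of `η₂`, from `η₁² + η₂² = 2 ν α` with `α = 1 - c²`. -/
def etaOne (c ν η₂ : ℝ) : ℝ := √(2 * ν * (1 - c ^ 2) - η₂ ^ 2)

/-- The modulus `k ≥ 0` with `k² = (η₁² - η₂²) / η₁²`. -/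
def modulus (c ν η₂ : ℝ) : ℝ :=
  √((etaOne c ν η₂ ^ 2 - η₂ ^ 2) / etaOne c ν η₂ ^ 2)

/-- The fundamental period `2 √(2α) K(k) / η₁` of the dnoidal wave with parameter `η₂`. -/
def wavePeriod (c ν η₂ : ℝ) : ℝ :=
  2 * √(2 * (1 - c ^ 2)) / etaOne c ν η₂ * ellipticK (modulus c ν η₂)

/-- The parameter `η₂ = η₂(ν)`: the (unique) `η₂ ∈ (0, √(να))` for which the dnoidal wave has
fundamental period `L`. It exists whenever `L > 0`, `α = 1 - c² > 0` and `ν > 2π² / L²`. -/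
def etaTwo (L c ν : ℝ) : ℝ :=
  Classical.epsilon fun η₂ : ℝ =>
    0 < η₂ ∧ η₂ < √(ν * (1 - c ^ 2)) ∧ wavePeriod c ν η₂ = L

/-- The dnoidal wave `φ_ν(ξ) = η₁ dn(η₁ ξ / √(2(1 - c²)); k)` of fundamental period `L`. -/
def phi (L c ν ξ : ℝ) : ℝ :=
  etaOne c ν (etaTwo L c ν) *
    jacobiDn (modulus c ν (etaTwo L c ν))
      (etaOne c ν (etaTwo L c ν) * ξ / √(2 * (1 - c ^ 2)))

/-- The dnoidal wave `ψ_ν(ξ) = -(η₁² / (1 - c²)) dn²(η₁ ξ / √(2(1 - c²)); k)`. -/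
def psi (L c ν ξ : ℝ) : ℝ :=
  -(etaOne c ν (etaTwo L c ν) ^ 2 / (1 - c ^ 2)) *
    jacobiDn (modulus c ν (etaTwo L c ν))
      (etaOne c ν (etaTwo L c ν) * ξ / √(2 * (1 - c ^ 2))) ^ 2

/-- `f` belongs to the periodic Sobolev space `H¹_per([0, L])` (complex valued functions) and `f'`
is (a representative of) its weak derivative: `f` and `f'` are square integrable over a period and
`∫₀ᴸ f θ' = - ∫₀ᴸ f' θ` for every smooth `L`-periodic `θ`. -/
structure IsH1Per (L : ℝ) (f f' : ℝ → ℂ) : Prop where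
  periodic : Function.Periodic f L
  memLp : MemLp f 2 (volume.restrict (Set.Ioc 0 L))
  memLp_deriv : MemLp f' 2 (volume.restrict (Set.Ioc 0 L))
  weak_deriv : ∀ θ : ℝ → ℂ, ContDiff ℝ ∞ θ → Function.Periodic θ L →
    ∫ x in (0 : ℝ)..L, f x * deriv θ x = -∫ x in (0 : ℝ)..L, f' x * θ x

/-- The inner product `(f, g) = ∫₀ᴸ f ḡ` of `L²_per([0, L])`. -/
def innerPer (L : ℝ) (f g : ℝ → ℂ) : ℂ :=
  ∫ x in (0 : ℝ)..L, f x * (starRingEnd ℂ) (g x)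

/-- The squared norm of `L²_per([0, L])`. -/
def normSqPer (L : ℝ) (f : ℝ → ℂ) : ℝ := ∫ x in (0 : ℝ)..L, ‖f x‖ ^ 2

/-- The value `(𝓛₃ f, f)` of the quadratic form of
`𝓛₃ = -d²/dx² - (ω + c²/4) + 3ψ_ν = -d²/dx² + ν + 3ψ_ν` (with `ν = -(ω + c²/4)`)
at `f ∈ H¹_per([0, L])` with weak derivative `f'`. -/
def formL3 (L c ν : ℝ) (f f' : ℝ → ℂ) : ℝ :=
  ∫ x in (0 : ℝ)..L, (‖f' x‖ ^ 2 + (ν + 3 * psi L c ν x) * ‖f x‖ ^ 2)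

/-- The values `(𝓛₃ f, f)` over `f ∈ H¹_per` with `‖f‖ = 1` and `(f, φ_ν) = 0`. -/
def valuesA (L c ν : ℝ) : Set ℝ :=
  {r | ∃ f f' : ℝ → ℂ, IsH1Per L f f' ∧ normSqPer L f = 1 ∧
    innerPer L f (fun x => (phi L c ν x : ℂ)) = 0 ∧
    r = formL3 L c ν f f'}

/-- The values `(𝓛₃ f, f)` over `f ∈ H¹_per` with `‖f‖ = 1`, `(f, φ_ν) = 0` and
`(f, (φ_ν ψ_ν)') = 0`. -/
def valuesB (L c ν : ℝ) : Set ℝ :=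
  {r | ∃ f f' : ℝ → ℂ, IsH1Per L f f' ∧ normSqPer L f = 1 ∧
    innerPer L f (fun x => (phi L c ν x : ℂ)) = 0 ∧
    innerPer L f (fun x => (deriv (fun y => phi L c ν y * psi L c ν y) x : ℂ)) = 0 ∧
    r = formL3 L c ν f f'}

end Zakharov

end

/-!
The dnoidal wave `φ = φ_ν` is a positive periodic solution of `φ'' = νφ - φ³ / α`, and
`ψ_ν = -φ² / α`, so `𝓛₃ = -d²/dx² + V` with `V = ν - 3φ² / α` is the linearization of this equation
at `φ`. Its kernel contains `φ'`, which is orthogonal to `φ`; hence the infimum in (a) is at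
most `0` (`DnoidalProfile.integral_form_deriv_eq_zero`). For the bounds from below no spectral
decomposition is needed, only the following two facts.

* There are `s` and `l > 0` such that `φ² - s` is an eigenfunction of `𝓛₃` with eigenvalue `l` (it
  is a Lamé polynomial). It vanishes exactly at two points `z` and `L - z` of a period. Jacobi's
  factorization `u'² + (V - l) u² = (u' - (w' / w) u)² + ((w' / w) u²)'`, with `w = φ² - s`, gives
  `(𝓛₃ v, v) ≥ l ‖v‖²` for all `v` that vanish at these two points
  (`IsH1On.form_nonneg`, `DnoidalProfile.exists_coercive_of_two_zeros`).
* The equation `𝓛₃ χ = φ` has an explicit even periodic solution with `(χ, φ) < 0`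
  (`DnoidalProfile.exists_periodic_solution`). With `p = max φ`, `q = min φ`, and `M` the mean of
  `φ²`, the sign comes from `M > pq`, which follows by integrating `(log φ)''` over a period.

If `u` is orthogonal to `φ`, choose `t` and `s` such that `v = u - tχ - sφ'` vanishes at `z` and
`L - z`. Since `𝓛₃ φ' = 0` and `(𝓛₃ χ, u) = (φ, u) = 0`, it follows that
`(𝓛₃ u, u) = (𝓛₃ v, v) - t² (χ, φ) ≥ l ‖v‖² + m t²` with `m = -(χ, φ) > 0`
(`DnoidalProfile.exists_decomposition`). This proves (a). Under the constraint of (b), which is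
orthogonality to `φ² φ'`, the coefficient `s` is controlled by `‖v‖` and `|t|`, because
`(φ', φ² φ') > 0`; hence `(𝓛₃ u, u) ≥ δ ‖u‖²` for some `δ > 0` (`DnoidalProfile.exists_coercive`).

These arguments concern real absolutely continuous functions. Functions of the periodic Sobolev
space are reduced to them by splitting into real and imaginary parts, and by Parseval's identity,
which shows that a weak derivative is the derivative of an absolutely continuous representative.
The parameter `η₂` exists by the intermediate value theorem: the period of the dnoidal wave is
continuous in `η₂`, is less than `L` at `η₂ = √(να)`, and is unbounded as `η₂ → 0`, where the
complete elliptic integral diverges logarithmically.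
-/

namespace Zakharov

/-! ### The Jacobi elliptic functions -/

section Elliptic

open Filter Topology

variable {k : ℝ}

lemma delta_pos (hk : k ^ 2 < 1) (t : ℝ) : 0 < 1 - k ^ 2 * Real.sin t ^ 2 := by
  nlinarith [Real.sin_sq_le_one t, sq_nonneg (Real.sin t), sq_nonneg k]

lemma continuous_ellipticF_integrand (hk : k ^ 2 < 1) :
    Continuous fun t => 1 / √(1 - k ^ 2 * Real.sin t ^ 2) := by
  refine continuous_const.div (by fun_prop) fun t => ?_
  exact (Real.sqrt_pos.2 (delta_pos hk t)).ne'

lemma hasDerivAt_ellipticF (hk : k ^ 2 < 1) (x : ℝ) :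
    HasDerivAt (ellipticF k) (1 / √(1 - k ^ 2 * Real.sin x ^ 2)) x :=
  (continuous_ellipticF_integrand hk).integral_hasStrictDerivAt 0 x |>.hasDerivAt

lemma ellipticF_zero : ellipticF k 0 = 0 := by simp [ellipticF]

lemma ellipticF_neg (x : ℝ) : ellipticF k (-x) = -ellipticF k x := by
  have h := intervalIntegral.integral_comp_neg (a := 0) (b := x)
    fun t => 1 / √(1 - k ^ 2 * Real.sin t ^ 2)
  simp only [Real.sin_neg, neg_sq, neg_zero] at h
  rw [ellipticF, ellipticF, h, intervalIntegral.integral_symm]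

lemma ellipticF_add_pi (hk : k ^ 2 < 1) (x : ℝ) :
    ellipticF k (x + Real.pi) = ellipticF k x + 2 * ellipticK k := by
  have hper : Function.Periodic (fun t => 1 / √(1 - k ^ 2 * Real.sin t ^ 2)) Real.pi := by
    intro t
    simp [Real.sin_add_pi]
  have hi : ∀ a b, IntervalIntegrable (fun t => 1 / √(1 - k ^ 2 * Real.sin t ^ 2)) volume a b :=
    fun a b => (continuous_ellipticF_integrand hk).intervalIntegrable a b
  have h1 := hper.intervalIntegral_add_eq x (-(Real.pi / 2))
  have h2 : -(Real.pi / 2) + Real.pi = Real.pi / 2 := by ring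
  rw [h2] at h1
  have h5 := intervalIntegral.integral_add_adjacent_intervals (hi (-(Real.pi / 2)) 0)
    (hi 0 (Real.pi / 2))
  rw [intervalIntegral.integral_symm] at h5
  have h3 := ellipticF_neg (k := k) (Real.pi / 2)
  have h4 := intervalIntegral.integral_add_adjacent_intervals (hi 0 x) (hi x (x + Real.pi))
  simp only [ellipticF, ellipticK] at *
  linarith

lemma strictMono_ellipticF (hk : k ^ 2 < 1) : StrictMono (ellipticF k) :=
  strictMono_of_deriv_pos fun x => by
    rw [(hasDerivAt_ellipticF hk x).deriv]
    exact one_div_pos.2 (Real.sqrt_pos.2 (delta_pos hk x))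

lemma continuous_ellipticF (hk : k ^ 2 < 1) : Continuous (ellipticF k) :=
  continuous_iff_continuousAt.2 fun x => (hasDerivAt_ellipticF hk x).continuousAt

lemma le_ellipticF (hk : k ^ 2 < 1) {x : ℝ} (hx : 0 ≤ x) : x ≤ ellipticF k x := by
  have h : ∫ _ in (0 : ℝ)..x, (1 : ℝ) ≤ ellipticF k x := by
    refine intervalIntegral.integral_mono_on hx (by simp)
      ((continuous_ellipticF_integrand hk).intervalIntegrable _ _) fun t _ => ?_
    rw [le_div_iff₀ (Real.sqrt_pos.2 (delta_pos hk t)), one_mul]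
    exact Real.sqrt_le_one.2 (by nlinarith [mul_nonneg (sq_nonneg k) (sq_nonneg (Real.sin t))])
  simpa using h

lemma surjective_ellipticF (hk : k ^ 2 < 1) : Function.Surjective (ellipticF k) := by
  refine (continuous_ellipticF hk).surjective ?_ ?_
  · exact tendsto_atTop_mono' _ (eventually_ge_atTop 0 |>.mono fun x hx => le_ellipticF hk hx)
      tendsto_id
  · refine tendsto_atBot_mono' _ (eventually_le_atBot 0 |>.mono fun x hx => ?_) tendsto_id
    have := le_ellipticF hk (x := -x) (by linarith)
    rw [ellipticF_neg] at this
    simp only [id]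
    linarith

lemma ellipticF_jacobiAm (hk : k ^ 2 < 1) (u : ℝ) : ellipticF k (jacobiAm k u) = u :=
  Function.rightInverse_invFun (surjective_ellipticF hk) u

lemma jacobiAm_ellipticF (hk : k ^ 2 < 1) (x : ℝ) : jacobiAm k (ellipticF k x) = x :=
  Function.leftInverse_invFun (strictMono_ellipticF hk).injective x

lemma strictMono_jacobiAm (hk : k ^ 2 < 1) : StrictMono (jacobiAm k) := fun u v huv => by
  rwa [← (strictMono_ellipticF hk).lt_iff_lt, ellipticF_jacobiAm hk, ellipticF_jacobiAm hk]

lemma continuous_jacobiAm (hk : k ^ 2 < 1) : Continuous (jacobiAm k) :=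
  (strictMono_jacobiAm hk).monotone.continuous_of_surjective
    fun x => ⟨_, jacobiAm_ellipticF hk x⟩

lemma jacobiAm_zero (hk : k ^ 2 < 1) : jacobiAm k 0 = 0 := by
  simpa [ellipticF_zero] using jacobiAm_ellipticF hk 0

lemma jacobiAm_ellipticK (hk : k ^ 2 < 1) : jacobiAm k (ellipticK k) = Real.pi / 2 :=
  jacobiAm_ellipticF hk _

lemma jacobiAm_neg (hk : k ^ 2 < 1) (u : ℝ) : jacobiAm k (-u) = -jacobiAm k u := by
  apply (strictMono_ellipticF hk).injective
  rw [ellipticF_neg, ellipticF_jacobiAm hk, ellipticF_jacobiAm hk]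

lemma jacobiAm_add_two_mul_ellipticK (hk : k ^ 2 < 1) (u : ℝ) :
    jacobiAm k (u + 2 * ellipticK k) = jacobiAm k u + Real.pi := by
  apply (strictMono_ellipticF hk).injective
  rw [ellipticF_add_pi hk, ellipticF_jacobiAm hk, ellipticF_jacobiAm hk]

lemma hasDerivAt_jacobiAm (hk : k ^ 2 < 1) (u : ℝ) :
    HasDerivAt (jacobiAm k) (jacobiDn k u) u := by
  have h := HasDerivAt.of_local_left_inverse (continuous_jacobiAm hk).continuousAt
    (hasDerivAt_ellipticF hk (jacobiAm k u))
    (one_div_pos.2 (Real.sqrt_pos.2 (delta_pos hk _))).ne'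
    (Eventually.of_forall fun v => ellipticF_jacobiAm hk v)
  simpa [jacobiDn] using h

lemma jacobiDn_pos (hk : k ^ 2 < 1) (u : ℝ) : 0 < jacobiDn k u :=
  Real.sqrt_pos.2 (delta_pos hk _)

lemma jacobiDn_sq (hk : k ^ 2 < 1) (u : ℝ) :
    jacobiDn k u ^ 2 = 1 - k ^ 2 * Real.sin (jacobiAm k u) ^ 2 :=
  Real.sq_sqrt (delta_pos hk _).le

lemma hasDerivAt_jacobiDn (hk : k ^ 2 < 1) (u : ℝ) :
    HasDerivAt (jacobiDn k)
      (-(k ^ 2 * Real.sin (jacobiAm k u) * Real.cos (jacobiAm k u))) u := by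
  have h1 := ((((hasDerivAt_jacobiAm hk u).sin.pow 2).const_mul (k ^ 2)).const_sub 1).sqrt
    (delta_pos hk _).ne'
  have h0 := jacobiDn_pos hk u
  refine h1.congr_deriv ?_
  change _ / (2 * jacobiDn k u) = _
  field_simp
  simp only [Nat.add_one_sub_one, Nat.cast_ofNat, pow_one]
  ring

lemma hasDerivAt_deriv_jacobiDn (hk : k ^ 2 < 1) (u : ℝ) :
    HasDerivAt (fun u => -(k ^ 2 * Real.sin (jacobiAm k u) * Real.cos (jacobiAm k u)))
      ((2 - k ^ 2) * jacobiDn k u - 2 * jacobiDn k u ^ 3) u := by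
  have h := hasDerivAt_jacobiAm hk u
  refine ((h.sin.const_mul (k ^ 2)).mul h.cos).neg.congr_deriv ?_
  have h2 := jacobiDn_sq hk u
  have h3 := Real.sin_sq_add_cos_sq (jacobiAm k u)
  linear_combination (2 * jacobiDn k u) * h2 - k ^ 2 * jacobiDn k u * h3

lemma deriv_jacobiDn_sq (hk : k ^ 2 < 1) (u : ℝ) :
    (-(k ^ 2 * Real.sin (jacobiAm k u) * Real.cos (jacobiAm k u))) ^ 2 =
      (1 - jacobiDn k u ^ 2) * (jacobiDn k u ^ 2 - (1 - k ^ 2)) := by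
  have h2 := jacobiDn_sq hk u
  have h3 := Real.sin_sq_add_cos_sq (jacobiAm k u)
  have h4 : Real.cos (jacobiAm k u) ^ 2 = 1 - Real.sin (jacobiAm k u) ^ 2 := by linarith
  rw [h2, neg_sq, mul_pow, h4]
  ring

lemma jacobiDn_zero (hk : k ^ 2 < 1) : jacobiDn k 0 = 1 := by
  simp [jacobiDn, jacobiAm_zero hk]

lemma jacobiDn_ellipticK (hk : k ^ 2 < 1) : jacobiDn k (ellipticK k) = √(1 - k ^ 2) := by
  simp [jacobiDn, jacobiAm_ellipticK hk]

lemma jacobiDn_neg (hk : k ^ 2 < 1) (u : ℝ) : jacobiDn k (-u) = jacobiDn k u := by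
  simp [jacobiDn, jacobiAm_neg hk]

lemma jacobiDn_periodic (hk : k ^ 2 < 1) : Function.Periodic (jacobiDn k) (2 * ellipticK k) := by
  intro u
  simp [jacobiDn, jacobiAm_add_two_mul_ellipticK hk, Real.sin_add_pi]

lemma deriv_jacobiDn_neg (hk : k ^ 2 < 1) (hk0 : 0 < k) {u : ℝ} (h0 : 0 < u)
    (h1 : u < ellipticK k) :
    -(k ^ 2 * Real.sin (jacobiAm k u) * Real.cos (jacobiAm k u)) < 0 := by
  have ha := strictMono_jacobiAm hk h0
  have hb := strictMono_jacobiAm hk h1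
  rw [jacobiAm_zero hk] at ha
  rw [jacobiAm_ellipticK hk] at hb
  have := Real.sin_pos_of_pos_of_lt_pi ha (by linarith [Real.pi_pos])
  have := Real.cos_pos_of_mem_Ioo ⟨by linarith, hb⟩
  have : 0 < k ^ 2 * Real.sin (jacobiAm k u) * Real.cos (jacobiAm k u) := by positivity
  linarith

end Elliptic

/-! ### Existence of a dnoidal wave with prescribed period -/

lemma continuousAt_ellipticK {k : ℝ} (hk : k ^ 2 < 1) : ContinuousAt ellipticK k := by
  -- Truncating the radicand from below gives an integrand that is continuous for every modulus
  -- and agrees with the original one for moduli near `k`.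
  set m : ℝ := (1 - k ^ 2) / 2 with hm
  have hm0 : 0 < m := by rw [hm]; linarith
  have hG : Continuous fun l : ℝ =>
      ∫ t in (0 : ℝ)..(Real.pi / 2), 1 / √(max (1 - l ^ 2 * Real.sin t ^ 2) m) := by
    refine intervalIntegral.continuous_parametric_intervalIntegral_of_continuous' ?_ _ _
    simp only [Function.uncurry_def]
    refine continuous_const.div (by fun_prop) fun p => ?_
    exact (Real.sqrt_pos.2 (lt_max_of_lt_right hm0)).ne'
  refine hG.continuousAt.congr ?_
  have h1 : ∀ᶠ l in nhds k, l ^ 2 < 1 - m :=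
    (continuous_pow 2).continuousAt.eventually_lt_const (by linarith)
  filter_upwards [h1] with l hl
  refine intervalIntegral.integral_congr fun t _ => ?_
  rw [max_eq_left]
  nlinarith [Real.sin_sq_le_one t, sq_nonneg l]

/-- The complete elliptic integral diverges at least logarithmically in the complementary
modulus. -/
lemma log_le_ellipticK {k κ : ℝ} (hκ : 0 < κ) (h : k ^ 2 + κ ^ 2 = 1) :
    Real.log (1 + Real.pi / 2 / κ) ≤ ellipticK k := by
  have hk : k ^ 2 < 1 := by nlinarith
  have hpos : ∀ t ∈ Set.uIcc 0 (Real.pi / 2), 0 < Real.pi / 2 - t + κ := by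
    intro t ht
    rw [Set.uIcc_of_le (by positivity)] at ht
    linarith [ht.2]
  have hd : ∀ t ∈ Set.uIcc 0 (Real.pi / 2),
      HasDerivAt (fun t => -Real.log (Real.pi / 2 - t + κ)) (1 / (Real.pi / 2 - t + κ)) t := by
    intro t ht
    have h1 : HasDerivAt (fun t => Real.pi / 2 - t + κ) (-1) t :=
      ((hasDerivAt_id t).const_sub _).add_const _
    exact (h1.log (hpos t ht).ne').neg.congr_deriv (by ring)
  have hi : IntervalIntegrable (fun t => 1 / (Real.pi / 2 - t + κ)) volume 0 (Real.pi / 2) := by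
    refine ContinuousOn.intervalIntegrable ?_
    exact continuousOn_const.div (by fun_prop) fun t ht => (hpos t ht).ne'
  have hint := intervalIntegral.integral_eq_sub_of_hasDerivAt hd hi
  have e : Real.log (1 + Real.pi / 2 / κ) = ∫ t in (0 : ℝ)..(Real.pi / 2),
      1 / (Real.pi / 2 - t + κ) := by
    rw [hint, sub_self, zero_add, sub_zero, neg_sub_neg, ← Real.log_div (by positivity) hκ.ne']
    congr 1
    field_simp
    ring
  rw [e]
  refine intervalIntegral.integral_mono_on (by positivity) hi
    ((continuous_ellipticF_integrand hk).intervalIntegrable _ _) fun t ht => ?_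
  refine one_div_le_one_div_of_le (Real.sqrt_pos.2 (delta_pos hk t)) ?_
  have h3 : 0 < Real.pi / 2 - t + κ := by linarith [ht.2]
  refine Real.sqrt_le_iff.2 ⟨h3.le, ?_⟩
  have h4 : Real.cos t ≤ Real.pi / 2 - t := by
    rw [← Real.sin_pi_div_two_sub]
    exact Real.sin_le (by linarith [ht.2])
  have h5 : 0 ≤ Real.cos t := Real.cos_nonneg_of_mem_Icc ⟨by linarith [ht.1, Real.pi_pos], ht.2⟩
  nlinarith [Real.sin_sq_add_cos_sq t, Real.sin_sq_le_one t, mul_nonneg (h5.trans h4) hκ.le,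
    mul_nonneg (sq_nonneg κ) (sq_nonneg (Real.cos t)), mul_self_le_mul_self h5 h4]

lemma etaOne_sq {c ν η : ℝ} (hη : η ^ 2 ≤ ν * (1 - c ^ 2)) (hα : 0 < ν * (1 - c ^ 2)) :
    etaOne c ν η ^ 2 = 2 * ν * (1 - c ^ 2) - η ^ 2 :=
  Real.sq_sqrt (by linarith)

lemma etaOne_pos {c ν η : ℝ} (hη : η ^ 2 ≤ ν * (1 - c ^ 2)) (hα : 0 < ν * (1 - c ^ 2)) :
    0 < etaOne c ν η :=
  Real.sqrt_pos.2 (by linarith)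

lemma modulus_sq {c ν η : ℝ} (hη : η ^ 2 ≤ ν * (1 - c ^ 2)) (hα : 0 < ν * (1 - c ^ 2)) :
    modulus c ν η ^ 2 = 1 - (η / etaOne c ν η) ^ 2 := by
  have h1 := etaOne_pos hη hα
  rw [modulus, Real.sq_sqrt, div_pow]
  · field_simp
  · rw [etaOne_sq hη hα]
    exact div_nonneg (by linarith) (by linarith)

/-- The period is continuous in `η₂`; it is less than `L` at `η₂ = √(να)`, because `ν > 2π² / L²`,
and at least `L` for a suitable small `η₂`, by the logarithmic divergence of `K`. -/
lemma exists_wavePeriod_eq {L c ν : ℝ} (hL : 0 < L) (hc : 0 < 1 - c ^ 2)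
    (hν : 2 * Real.pi ^ 2 / L ^ 2 < ν) :
    ∃ η₂ : ℝ, 0 < η₂ ∧ η₂ < √(ν * (1 - c ^ 2)) ∧ wavePeriod c ν η₂ = L := by
  have hν0 : 0 < ν := lt_trans (by positivity) hν
  have hα : 0 < ν * (1 - c ^ 2) := by positivity
  set b : ℝ := √(ν * (1 - c ^ 2)) with hb
  have hb0 : 0 < b := Real.sqrt_pos.2 hα
  have hb2 : b ^ 2 = ν * (1 - c ^ 2) := Real.sq_sqrt hα.le
  have hnu : √(2 * (1 - c ^ 2)) = √2 * b / √ν := by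
    rw [hb, Real.sqrt_mul (by norm_num), Real.sqrt_mul hν0.le]
    have := Real.sqrt_pos.2 hν0
    field_simp
  have hsν := Real.sqrt_pos.2 hν0
  have hsν2 := Real.sq_sqrt hν0.le
  have hs2 : √(2 : ℝ) ^ 2 = 2 := Real.sq_sqrt (by norm_num)
  -- This ratio `η₂ / √(να)` makes the logarithmic lower bound for the period exceed `L`.
  set e : ℝ := Real.exp (-(L * √ν / 2)) with he
  have he0 : 0 < e := Real.exp_pos _
  have he1 : e ≤ 1 := Real.exp_le_one_iff.2 (by linarith [mul_pos hL hsν])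
  have hsq : ∀ η ∈ Set.Icc (b * e) b, η ^ 2 ≤ ν * (1 - c ^ 2) := by
    intro η hη
    rw [← hb2]
    exact pow_le_pow_left₀ (le_trans (by positivity) hη.1) hη.2 2
  have hcont : ContinuousOn (wavePeriod c ν) (Set.Icc (b * e) b) := by
    intro η hη
    have h1 := etaOne_pos (hsq η hη) hα
    have h0 : 0 < η := lt_of_lt_of_le (by positivity) hη.1
    have hcE : Continuous (etaOne c ν) := by unfold etaOne; fun_prop
    have hcM : ContinuousAt (modulus c ν) η := by
      unfold modulus
      exact ContinuousAt.sqrt (((hcE.pow 2).sub (continuous_pow 2)).continuousAt.div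
        (hcE.pow 2).continuousAt (by positivity))
    have hk : modulus c ν η ^ 2 < 1 := by
      rw [modulus_sq (hsq η hη) hα]
      have : 0 < (η / etaOne c ν η) ^ 2 := by positivity
      linarith
    have hK : ContinuousAt (fun η => ellipticK (modulus c ν η)) η :=
      (continuousAt_ellipticK hk).comp (f := modulus c ν) hcM
    exact ((continuousAt_const.div hcE.continuousAt h1.ne').mul hK).continuousWithinAt
  have hbe : b * e ≤ b := by nlinarith
  have hmem_l : b * e ∈ Set.Icc (b * e) b := ⟨le_rfl, hbe⟩
  have hmem_r : b ∈ Set.Icc (b * e) b := ⟨hbe, le_rfl⟩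
  have hright : wavePeriod c ν b < L := by
    have h2 : etaOne c ν b = b := by
      rw [etaOne, hb2, hb]
      congr 1
      ring
    have h3 : modulus c ν b = 0 := by simp [modulus, h2]
    have h4 : ellipticK 0 = Real.pi / 2 := by simp [ellipticK, ellipticF]
    rw [wavePeriod, h2, h3, h4, hnu]
    have h5 : 2 * Real.pi ^ 2 < ν * L ^ 2 := by
      rwa [div_lt_iff₀ (by positivity)] at hν
    have h6 : 2 * (√2 * b / √ν) / b * (Real.pi / 2) = √2 * Real.pi / √ν := by
      field_simp
    rw [h6, div_lt_iff₀ hsν]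
    refine lt_of_pow_lt_pow_left₀ 2 (by positivity) ?_
    rw [mul_pow, mul_pow, hs2, hsν2]
    linarith
  have hleft : L ≤ wavePeriod c ν (b * e) := by
    have h1 := etaOne_pos (hsq _ hmem_l) hα
    have h2 := etaOne_sq (hsq _ hmem_l) hα
    have h3 : b ≤ etaOne c ν (b * e) := by
      refine (sq_le_sq₀ hb0.le h1.le).1 ?_
      rw [h2, hb2]
      linarith [hsq _ hmem_l]
    have h3' : etaOne c ν (b * e) ≤ √2 * b := by
      refine (sq_le_sq₀ h1.le (by positivity)).1 ?_
      rw [h2, mul_pow √2, hs2, hb2]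
      linarith [sq_nonneg (b * e)]
    have hκ0 : 0 < b * e / etaOne c ν (b * e) := by positivity
    have h4 : Real.log (1 + Real.pi / 2 / (b * e / etaOne c ν (b * e))) ≤
        ellipticK (modulus c ν (b * e)) :=
      log_le_ellipticK hκ0 (by rw [modulus_sq (hsq _ hmem_l) hα]; ring)
    have h5 : L * √ν / 2 ≤ Real.log (1 + Real.pi / 2 / (b * e / etaOne c ν (b * e))) := by
      rw [Real.le_log_iff_exp_le (by positivity)]
      have h6 : Real.exp (L * √ν / 2) = 1 / e := by rw [he, Real.exp_neg]; simp
      have h7 : b * e / etaOne c ν (b * e) ≤ e := by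
        rw [div_le_iff₀ h1]
        nlinarith
      have h8 : 1 / e ≤ Real.pi / 2 / (b * e / etaOne c ν (b * e)) := by
        rw [div_le_div_iff₀ he0 hκ0]
        nlinarith [Real.pi_gt_three]
      rw [h6]
      linarith
    have h9 : 2 / √ν ≤ 2 * √(2 * (1 - c ^ 2)) / etaOne c ν (b * e) := by
      rw [hnu, div_le_div_iff₀ hsν h1]
      have : 2 * (√2 * b / √ν) * √ν = 2 * (√2 * b) := by field_simp
      rw [this]
      linarith
    calc L = 2 / √ν * (L * √ν / 2) := by field_simp
      _ ≤ _ := mul_le_mul h9 (h5.trans h4) (by positivity) (by positivity)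
  obtain ⟨η, hη, hηL⟩ := intermediate_value_Icc' hbe hcont ⟨hright.le, hleft⟩
  refine ⟨η, lt_of_lt_of_le (by positivity) hη.1, lt_of_le_of_ne hη.2 ?_, hηL⟩
  rintro rfl
  exact hright.ne hηL

lemma etaTwo_spec {L c ν : ℝ} (hL : 0 < L) (hc : 0 < 1 - c ^ 2)
    (hν : 2 * Real.pi ^ 2 / L ^ 2 < ν) :
    0 < etaTwo L c ν ∧ etaTwo L c ν < √(ν * (1 - c ^ 2)) ∧
      wavePeriod c ν (etaTwo L c ν) = L :=
  Classical.epsilon_spec (exists_wavePeriod_eq hL hc hν)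

/-! ### The profile equation -/

/-- The properties of the dnoidal wave `φ` with derivative `φ'` on which the spectral analysis
rests: `φ` is a positive, even, `L`-periodic solution of `φ'' = νφ - φ³ / α` with first integral
`2α φ'² = (p² - φ²)(φ² - q²)`, which decreases from `p = φ 0` to `q = φ (L / 2)` on the half
period. -/
structure DnoidalProfile (L α ν p q : ℝ) (φ φ' : ℝ → ℝ) : Prop where
  period_pos : 0 < L
  alpha_pos : 0 < α
  q_pos : 0 < q
  q_lt_p : q < p
  sum_sq : p ^ 2 + q ^ 2 = 2 * ν * α
  hasDerivAt : ∀ x, HasDerivAt φ (φ' x) x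
  hasDerivAt' : ∀ x, HasDerivAt φ' (ν * φ x - φ x ^ 3 / α) x
  first_integral : ∀ x, φ' x ^ 2 = (p ^ 2 - φ x ^ 2) * (φ x ^ 2 - q ^ 2) / (2 * α)
  pos : ∀ x, 0 < φ x
  periodic : Function.Periodic φ L
  even : ∀ x, φ (-x) = φ x
  apply_zero : φ 0 = p
  apply_half : φ (L / 2) = q
  deriv_neg : ∀ x, 0 < x → x < L / 2 → φ' x < 0

lemma exists_dnoidalProfile_phi {L c ν : ℝ} (hL : 0 < L) (hc : 0 < 1 - c ^ 2)
    (hν : 2 * Real.pi ^ 2 / L ^ 2 < ν) :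
    ∃ p q φ', DnoidalProfile L (1 - c ^ 2) ν p q (phi L c ν) φ' := by
  obtain ⟨hq0, hq1, hper⟩ := etaTwo_spec hL hc hν
  have hν0 : 0 < ν := lt_trans (by positivity) hν
  have hα : 0 < ν * (1 - c ^ 2) := by positivity
  set q := etaTwo L c ν with hq
  have hq2 : q ^ 2 < ν * (1 - c ^ 2) := (Real.lt_sqrt hq0.le).1 hq1
  have hp2 := etaOne_sq hq2.le hα
  have hp0 := etaOne_pos hq2.le hα
  have hk2 := modulus_sq hq2.le hα
  set p := etaOne c ν q with hp
  set k := modulus c ν q with hk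
  set r := √(2 * (1 - c ^ 2)) with hr
  have hr0 : 0 < r := Real.sqrt_pos.2 (by linarith)
  have hr2 : r ^ 2 = 2 * (1 - c ^ 2) := Real.sq_sqrt (by linarith)
  have hqp : q < p := by
    refine (sq_lt_sq₀ hq0.le hp0.le).1 ?_
    rw [hp2]
    linarith
  have hk1 : k ^ 2 < 1 := by
    rw [hk2]
    have : 0 < (q / p) ^ 2 := by positivity
    linarith
  have hk0 : 0 < k := by
    have h0 : 0 ≤ k := Real.sqrt_nonneg _
    refine lt_of_le_of_ne h0 fun h => ?_
    have h1 : (q / p) ^ 2 < 1 := by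
      rw [div_pow, div_lt_one (by positivity)]
      exact pow_lt_pow_left₀ hqp hq0.le two_ne_zero
    rw [← h] at hk2
    linarith
  have hφ : ∀ x, phi L c ν x = p * jacobiDn k (p * x / r) := fun x => rfl
  have hlin : ∀ x, HasDerivAt (fun x => p * x / r) (p / r) x := fun x => by
    simpa using ((hasDerivAt_id x).const_mul p).div_const r
  have hshift : p * L / r = 2 * ellipticK k := by
    rw [← hper]
    change p * (2 * r / p * ellipticK k) / r = 2 * ellipticK k
    field_simp
  have hr2' : 1 - c ^ 2 = r ^ 2 / 2 := by linarith
  have hkp : p ^ 2 * (1 - k ^ 2) = q ^ 2 := by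
    rw [hk2]
    field_simp
    ring
  have hν' : ν * r ^ 2 = p ^ 2 + q ^ 2 := by
    rw [hr2]
    linarith
  let D : ℝ → ℝ := fun u => -(k ^ 2 * Real.sin (jacobiAm k u) * Real.cos (jacobiAm k u))
  refine ⟨p, q, fun x => p * (D (p * x / r) * (p / r)), ?_⟩
  refine ⟨hL, hc, hq0, hqp, by linarith, fun x => ?_, fun x => ?_, fun x => ?_, fun x => ?_,
    fun x => ?_, fun x => ?_, ?_, ?_, fun x h0 h1 => ?_⟩
  · exact ((hasDerivAt_jacobiDn hk1 _).comp x (hlin x)).const_mul p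
  · refine ((((hasDerivAt_deriv_jacobiDn hk1 _).comp x (hlin x)).mul_const _).const_mul
      p).congr_deriv ?_
    rw [hφ, hr2']
    have h1 : ν = (p ^ 2 + q ^ 2) / r ^ 2 := by
      field_simp
      linarith
    rw [h1, ← hkp]
    field_simp
    ring
  · have h1 := deriv_jacobiDn_sq hk1 (p * x / r)
    rw [mul_pow, mul_pow, h1, hφ, ← hkp, hr2', div_pow]
    field_simp
  · rw [hφ]
    exact mul_pos hp0 (jacobiDn_pos hk1 _)
  · rw [hφ, hφ, mul_add, add_div, hshift, jacobiDn_periodic hk1]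
  · rw [hφ, hφ, mul_neg, neg_div, jacobiDn_neg hk1]
  · rw [hφ, mul_zero, zero_div, jacobiDn_zero hk1, mul_one]
  · have h1 : p * (L / 2) / r = ellipticK k := by
      rw [show p * (L / 2) / r = p * L / r / 2 by ring]
      linarith
    rw [hφ, h1, jacobiDn_ellipticK hk1]
    have h2 : 1 - k ^ 2 = (q / p) ^ 2 := by linarith
    rw [h2, Real.sqrt_sq (by positivity)]
    field_simp
  · have h1 : p * x / r < ellipticK k := by
      have : p * L / r / 2 = ellipticK k := by linarith
      rw [← this]
      have h2 : p * x / r = p * (2 * x) / r / 2 := by ring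
      rw [h2]
      gcongr
      linarith
    have h2 := deriv_jacobiDn_neg hk1 hk0 (u := p * x / r) (by positivity) h1
    have h3 : 0 < p / r := by positivity
    exact mul_neg_of_pos_of_neg hp0 (mul_neg_of_neg_of_pos h2 h3)

lemma psi_eq (L c ν x : ℝ) : psi L c ν x = -(phi L c ν x ^ 2 / (1 - c ^ 2)) := by
  rw [psi, phi, mul_pow]
  ring

/-! ### Absolutely continuous functions with square integrable derivative -/

/-- `u` is a real function of class `H¹` on the interval between `a` and `b`: it is absolutely
continuous there and `g` is (a representative of) its derivative, with `g²` integrable. -/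
structure IsH1On (a b : ℝ) (u g : ℝ → ℝ) : Prop where
  absCont : AbsolutelyContinuousOnInterval u a b
  ae_hasDerivAt : ∀ᵐ x, x ∈ Set.uIcc a b → HasDerivAt u (g x) x
  sq_integrable : IntervalIntegrable (fun x => g x ^ 2) volume a b

namespace IsH1On

variable {a b c d : ℝ} {u g w h : ℝ → ℝ}

lemma ae_deriv_eq (hu : IsH1On a b u g) : ∀ᵐ x, x ∈ Set.uIoc a b → deriv u x = g x := by
  filter_upwards [hu.ae_hasDerivAt] with x hx hxm
  exact (hx (Set.uIoc_subset_uIcc hxm)).deriv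

lemma continuousOn (hu : IsH1On a b u g) : ContinuousOn u (Set.uIcc a b) :=
  hu.absCont.continuousOn

lemma integrable (hu : IsH1On a b u g) : IntervalIntegrable g volume a b :=
  hu.absCont.intervalIntegrable_deriv.congr_ae
    ((ae_restrict_iff' measurableSet_uIoc).2 hu.ae_deriv_eq)

lemma mono (hu : IsH1On a b u g) (hs : Set.uIcc c d ⊆ Set.uIcc a b) : IsH1On c d u g where
  absCont := hu.absCont.mono hs
  ae_hasDerivAt := hu.ae_hasDerivAt.mono fun _ hx hxm => hx (hs hxm)
  sq_integrable := hu.sq_integrable.mono_set hs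

lemma of_hasDerivAt (hu : ∀ x, HasDerivAt u (g x) x) (hg : Continuous g) : IsH1On a b u g where
  absCont := by
    refine ContDiffOn.absolutelyContinuousOnInterval (ContDiff.contDiffOn ?_)
    refine contDiff_one_iff_deriv.2 ⟨fun x => (hu x).differentiableAt, ?_⟩
    rwa [funext fun x => (hu x).deriv]
  ae_hasDerivAt := Filter.Eventually.of_forall fun x _ => hu x
  sq_integrable := (hg.pow 2).intervalIntegrable _ _

lemma mul_integrable (hu : IsH1On a b u g) (hw : ContinuousOn w (Set.uIcc a b)) :
    IntervalIntegrable (fun x => g x * w x) volume a b :=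
  hu.integrable.mul_continuousOn hw

lemma mul_continuousOn_integrable (hu : IsH1On a b u g) (hw : ContinuousOn w (Set.uIcc a b)) :
    IntervalIntegrable (fun x => u x * w x) volume a b :=
  (hu.continuousOn.mul hw).intervalIntegrable

/-- Integration by parts for functions of class `H¹`. -/
lemma integral_mul_add (hu : IsH1On a b u g) (hw : IsH1On a b w h) :
    ∫ x in a..b, (g x * w x + u x * h x) = u b * w b - u a * w a := by
  rw [← hu.absCont.integral_deriv_mul_eq_sub hw.absCont]
  refine intervalIntegral.integral_congr_ae ?_
  filter_upwards [hu.ae_deriv_eq, hw.ae_deriv_eq] with x h1 h2 hx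
  rw [h1 hx, h2 hx]

lemma integral_eq_sub (hu : IsH1On a b u g) : ∫ x in a..b, g x = u b - u a := by
  rw [← hu.absCont.integral_deriv_eq_sub]
  refine intervalIntegral.integral_congr_ae ?_
  filter_upwards [hu.ae_deriv_eq] with x h1 hx
  rw [h1 hx]

lemma sub (hu : IsH1On a b u g) (hw : ∀ x, HasDerivAt w (h x) x) (hh : Continuous h) :
    IsH1On a b (fun x => u x - w x) (fun x => g x - h x) where
  absCont := hu.absCont.fun_sub (of_hasDerivAt hw hh).absCont
  ae_hasDerivAt := hu.ae_hasDerivAt.mono fun x hx hxm => (hx hxm).sub (hw x)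
  sq_integrable := by
    have h1 : IntervalIntegrable (fun x => g x ^ 2 - 2 * (g x * h x) + h x ^ 2) volume a b :=
      (hu.sq_integrable.sub ((hu.mul_integrable hh.continuousOn).const_mul 2)).add
        ((hh.pow 2).intervalIntegrable _ _)
    refine h1.congr fun x _ => ?_
    ring

/-- The elementary Hölder estimate of exponent `1 / 2`. -/
lemma sq_sub_le (hu : IsH1On a b u g) (hab : a ≤ b) :
    (u b - u a) ^ 2 ≤ (b - a) * ∫ x in a..b, g x ^ 2 := by
  rcases hab.eq_or_lt with rfl | hlt
  · simp
  set D := u b - u a with hD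
  have hba : 0 < b - a := sub_pos.2 hlt
  have h1 : 0 ≤ ∫ x in a..b, (g x - D / (b - a)) ^ 2 :=
    intervalIntegral.integral_nonneg hab fun x _ => sq_nonneg _
  have h2 : ∫ x in a..b, (g x - D / (b - a)) ^ 2 =
      (∫ x in a..b, g x ^ 2) - 2 * (D / (b - a)) * D + (b - a) * (D / (b - a)) ^ 2 := by
    have e : ∀ x, (g x - D / (b - a)) ^ 2 =
        g x ^ 2 - 2 * (D / (b - a)) * g x + (D / (b - a)) ^ 2 := fun x => by ring
    simp_rw [e]
    rw [intervalIntegral.integral_add (hu.sq_integrable.sub (hu.integrable.const_mul _))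
      (by simp), intervalIntegral.integral_sub hu.sq_integrable (hu.integrable.const_mul _),
      intervalIntegral.integral_const_mul, hu.integral_eq_sub, intervalIntegral.integral_const,
      smul_eq_mul]
  have h3 : 2 * (D / (b - a)) * D - (b - a) * (D / (b - a)) ^ 2 = D ^ 2 / (b - a) := by
    field_simp
    ring
  have h4 : D ^ 2 / (b - a) ≤ ∫ x in a..b, g x ^ 2 := by linarith
  rwa [div_le_iff₀' hba] at h4

end IsH1On

/-! ### Absolutely continuous representatives of periodic weakly differentiable functions -/

/-- A square integrable function that is orthogonal to all derivatives of smooth periodic functions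
is constant: all its Fourier coefficients but the zeroth vanish. -/
lemma ae_eq_const_of_integral_mul_deriv_eq_zero {L : ℝ} (hL : 0 < L) {h : ℝ → ℝ}
    (hh : MemLp h 2 (volume.restrict (Set.Ioc 0 L)))
    (H : ∀ θ : ℝ → ℝ, ContDiff ℝ ∞ θ → Function.Periodic θ L →
      ∫ x in (0 : ℝ)..L, h x * deriv θ x = 0) :
    ∃ m : ℝ, ∀ᵐ x ∂volume.restrict (Set.Ioc 0 L), h x = m := by
  have hint : IntervalIntegrable h volume 0 L :=
    (intervalIntegrable_iff_integrableOn_Ioc_of_le hL.le).2 (hh.integrable one_le_two)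
  have hint2 : IntervalIntegrable (fun x => h x ^ 2) volume 0 L :=
    (intervalIntegrable_iff_integrableOn_Ioc_of_le hL.le).2 hh.integrable_sq
  have hcoef : ∀ n : ℤ, n ≠ 0 → fourierCoeffOn hL (fun x => (h x : ℂ)) n = 0 := by
    intro n hn
    have hκ : 2 * Real.pi * n / L ≠ 0 := by
      have : (n : ℝ) ≠ 0 := by exact_mod_cast hn
      positivity
    set κ : ℝ := 2 * Real.pi * n / L with hκdef
    have hκL : κ * L = n * (2 * Real.pi) := by
      rw [hκdef]
      field_simp
    have hlin : ∀ x, HasDerivAt (fun x => κ * x) κ x := fun x => by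
      simpa using (hasDerivAt_id x).const_mul κ
    have hcos : ∫ x in (0 : ℝ)..L, h x * Real.cos (κ * x) = 0 := by
      have hd : deriv (fun x => Real.sin (κ * x) / κ) = fun x => Real.cos (κ * x) :=
        funext fun x => (((hlin x).sin.div_const κ).congr_deriv (by field_simp)).deriv
      have := H (fun x => Real.sin (κ * x) / κ) (by fun_prop) fun x => by
        simp only [mul_add, hκL, Real.sin_add_int_mul_two_pi]
      rwa [hd] at this
    have hsin : ∫ x in (0 : ℝ)..L, h x * Real.sin (κ * x) = 0 := by
      have hd : deriv (fun x => -Real.cos (κ * x) / κ) = fun x => Real.sin (κ * x) :=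
        funext fun x => (((hlin x).cos.fun_neg.div_const κ).congr_deriv (by field_simp)).deriv
      have := H (fun x => -Real.cos (κ * x) / κ) (by fun_prop) fun x => by
        simp only [mul_add, hκL, Real.cos_add_int_mul_two_pi]
      rwa [hd] at this
    have e : ∀ x : ℝ, fourier (-n) (x : AddCircle (L - 0)) • (h x : ℂ) =
        ((h x * Real.cos (κ * x) : ℝ) : ℂ) - ((h x * Real.sin (κ * x) : ℝ) : ℂ) * Complex.I := by
      intro x
      have e1 : 2 * (Real.pi : ℂ) * Complex.I * ((-n : ℤ) : ℂ) * x / ((L - 0 : ℝ) : ℂ) =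
          ((-(κ * x) : ℝ) : ℂ) * Complex.I := by
        rw [hκdef]
        push_cast
        rw [sub_zero]
        ring
      rw [fourier_coe_apply, e1, Complex.exp_mul_I, ← Complex.ofReal_cos, ← Complex.ofReal_sin,
        Real.cos_neg, Real.sin_neg, smul_eq_mul]
      push_cast
      ring
    have hc1 : Continuous fun x => Real.cos (κ * x) := by fun_prop
    have hc2 : Continuous fun x => Real.sin (κ * x) := by fun_prop
    have i1 : IntervalIntegrable (fun x => ((h x * Real.cos (κ * x) : ℝ) : ℂ)) volume 0 L :=
      ⟨(hint.mul_continuousOn hc1.continuousOn).1.ofReal,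
        (hint.mul_continuousOn hc1.continuousOn).2.ofReal⟩
    have i2 : IntervalIntegrable (fun x => ((h x * Real.sin (κ * x) : ℝ) : ℂ)) volume 0 L :=
      ⟨(hint.mul_continuousOn hc2.continuousOn).1.ofReal,
        (hint.mul_continuousOn hc2.continuousOn).2.ofReal⟩
    rw [fourierCoeffOn_eq_integral]
    simp_rw [e]
    rw [intervalIntegral.integral_sub i1 (i2.mul_const _), intervalIntegral.integral_mul_const,
      intervalIntegral.integral_ofReal, intervalIntegral.integral_ofReal, hcos, hsin]
    simp
  set m : ℝ := L⁻¹ * ∫ x in (0 : ℝ)..L, h x with hm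
  have h0 : fourierCoeffOn hL (fun x => (h x : ℂ)) 0 = (m : ℂ) := by
    rw [fourierCoeffOn_eq_integral]
    simp only [neg_zero, fourier_zero, one_smul, intervalIntegral.integral_ofReal, hm]
    simp
  have hpars := hasSum_sq_fourierCoeffOn (f := fun x => (h x : ℂ)) hL hh.ofReal
  have hpars' := hasSum_single (f := fun n => ‖fourierCoeffOn hL (fun x => (h x : ℂ)) n‖ ^ 2) 0
    fun n hn => by simp [hcoef n hn]
  have hsq : ∫ x in (0 : ℝ)..L, h x ^ 2 = L * m ^ 2 := by
    have := hpars.unique hpars'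
    simp only [h0, Complex.norm_real, Real.norm_eq_abs, sq_abs, sub_zero, smul_eq_mul] at this
    rw [← this]
    field_simp
  have hmL : ∫ x in (0 : ℝ)..L, h x = L * m := by
    rw [hm]
    field_simp
  have hzero : ∫ x in (0 : ℝ)..L, (h x - m) ^ 2 = 0 := by
    have e : ∀ x, (h x - m) ^ 2 = h x ^ 2 - 2 * m * h x + m ^ 2 := fun x => by ring
    simp_rw [e]
    rw [intervalIntegral.integral_add (hint2.sub (hint.const_mul _)) (by simp),
      intervalIntegral.integral_sub hint2 (hint.const_mul _),
      intervalIntegral.integral_const_mul, hsq, hmL, intervalIntegral.integral_const, smul_eq_mul]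
    ring
  refine ⟨m, ?_⟩
  have hmem : MemLp (fun x => h x - m) 2 (volume.restrict (Set.Ioc 0 L)) :=
    hh.sub (memLp_const m)
  rw [intervalIntegral.integral_of_le hL.le,
    integral_eq_zero_iff_of_nonneg (fun x => sq_nonneg _) hmem.integrable_sq] at hzero
  filter_upwards [hzero] with x hx
  have : (h x - m) ^ 2 = 0 := hx
  exact sub_eq_zero.1 (pow_eq_zero_iff two_ne_zero |>.1 this)

/-- A weakly differentiable periodic function agrees almost everywhere with a function of class
`H¹` that takes the same value at both ends of the period. -/
lemma exists_isH1On_of_weak_deriv {L : ℝ} (hL : 0 < L) {f g : ℝ → ℝ}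
    (hf : MemLp f 2 (volume.restrict (Set.Ioc 0 L)))
    (hg : MemLp g 2 (volume.restrict (Set.Ioc 0 L)))
    (H : ∀ θ : ℝ → ℝ, ContDiff ℝ ∞ θ → Function.Periodic θ L →
      ∫ x in (0 : ℝ)..L, f x * deriv θ x = -∫ x in (0 : ℝ)..L, g x * θ x) :
    ∃ u : ℝ → ℝ, IsH1On 0 L u g ∧ u L = u 0 ∧
      ∀ᵐ x ∂volume.restrict (Set.Ioc 0 L), f x = u x := by
  have hint : IntervalIntegrable g volume 0 L :=
    (intervalIntegrable_iff_integrableOn_Ioc_of_le hL.le).2 (hg.integrable one_le_two)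
  have hfint : IntervalIntegrable f volume 0 L :=
    (intervalIntegrable_iff_integrableOn_Ioc_of_le hL.le).2 (hf.integrable one_le_two)
  have hint2 : IntervalIntegrable (fun x => g x ^ 2) volume 0 L :=
    (intervalIntegrable_iff_integrableOn_Ioc_of_le hL.le).2 hg.integrable_sq
  set F : ℝ → ℝ := fun x => ∫ t in (0 : ℝ)..x, g t with hF
  have h0 : F 0 = 0 := by simp [hF]
  have hFL : F L = 0 := by
    have := H (fun _ => 1) contDiff_const fun _ => rfl
    simp only [deriv_const, mul_zero, intervalIntegral.integral_zero, mul_one] at this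
    simp only [hF]
    linarith
  have hFH : IsH1On 0 L F g := by
    refine ⟨hint.absolutelyContinuousOnInterval_intervalIntegral Set.left_mem_uIcc, ?_, hint2⟩
    exact hint.ae_hasDerivAt_integral.mono fun x hx hxm => hx hxm 0 Set.left_mem_uIcc
  have hFc : ContinuousOn F (Set.Icc 0 L) := by
    have := hFH.continuousOn
    rwa [Set.uIcc_of_le hL.le] at this
  obtain ⟨C, hC⟩ := isCompact_Icc.exists_bound_of_continuousOn hFc
  have hFmem : MemLp F 2 (volume.restrict (Set.Ioc 0 L)) :=
    MemLp.of_bound ((hFc.mono Set.Ioc_subset_Icc_self).aestronglyMeasurable measurableSet_Ioc)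
      C ((ae_restrict_iff' measurableSet_Ioc).2
        (Filter.Eventually.of_forall fun x hx => hC x (Set.Ioc_subset_Icc_self hx)))
  obtain ⟨m, hm⟩ := ae_eq_const_of_integral_mul_deriv_eq_zero hL (h := fun x => f x - F x)
    (hf.sub hFmem) fun θ hθ hθL => by
      have hθd : ∀ x, HasDerivAt θ (deriv θ x) x := fun x =>
        (hθ.differentiable (by simp)).differentiableAt.hasDerivAt
      have hθc : Continuous (deriv θ) := hθ.continuous_deriv (by simp)
      have h1 := hFH.integral_mul_add (IsH1On.of_hasDerivAt hθd hθc)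
      have h2 := H θ hθ hθL
      rw [intervalIntegral.integral_add (hFH.mul_integrable hθ.continuous.continuousOn)
        (hFH.mul_continuousOn_integrable hθc.continuousOn), h0, hFL] at h1
      simp_rw [sub_mul]
      rw [intervalIntegral.integral_sub (hfint.mul_continuousOn hθc.continuousOn)
        (hFH.mul_continuousOn_integrable hθc.continuousOn), h2]
      linarith
  refine ⟨fun x => F x - -m, hFH.sub (w := fun _ => -m) (h := fun _ => 0)
    (fun x => hasDerivAt_const x _) continuous_const |> fun h => ?_, by simp [h0, hFL], ?_⟩
  · simpa using h
  · filter_upwards [hm] with x hx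
    linarith

/-! ### Jacobi's inequality -/

open Filter Topology in
/-- A function of class `H¹` that vanishes at `c` satisfies `u(x)² = o(|x - c|)` at `c`. -/
lemma IsH1On.tendsto_sq_div {a b c : ℝ} {u g : ℝ → ℝ} (hu : IsH1On a b u g) (hab : a < b)
    (hc : c ∈ Set.Icc a b) (huc : u c = 0) :
    Tendsto (fun x => u x ^ 2 / (x - c)) (𝓝[Set.Ioo a b] c) (𝓝 0) := by
  have hprim : ContinuousOn (fun x => ∫ t in c..x, g t ^ 2) (Set.Icc a b) := by
    have := intervalIntegral.continuousOn_primitive_interval' hu.sq_integrable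
      (by rwa [Set.uIcc_of_le hab.le])
    rwa [Set.uIcc_of_le hab.le] at this
  have h0 : Tendsto (fun x => |∫ t in c..x, g t ^ 2|) (𝓝[Set.Ioo a b] c) (𝓝 0) := by
    have := ((hprim c hc).mono Set.Ioo_subset_Icc_self).abs.tendsto
    simpa using this
  refine squeeze_zero_norm' ?_ h0
  filter_upwards [self_mem_nhdsWithin] with x hx
  rw [Real.norm_eq_abs, abs_div, abs_of_nonneg (sq_nonneg (u x))]
  have hsub : ∀ y z, y ∈ Set.Icc a b → z ∈ Set.Icc a b → Set.uIcc y z ⊆ Set.uIcc a b :=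
    fun y z hy hz => by
      rw [Set.uIcc_of_le hab.le]
      exact Set.uIcc_subset_Icc hy hz
  have hx' : x ∈ Set.Icc a b := Set.Ioo_subset_Icc_self hx
  refine div_le_of_le_mul₀ (abs_nonneg _) (abs_nonneg _) ?_
  rcases le_total c x with h | h
  · have := (hu.mono (hsub c x hc hx')).sq_sub_le h
    rw [huc, sub_zero] at this
    rw [abs_of_nonneg (sub_nonneg.2 h), mul_comm]
    exact this.trans (mul_le_mul_of_nonneg_left (le_abs_self _) (sub_nonneg.2 h))
  · have := (hu.mono (hsub x c hx' hc)).sq_sub_le h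
    rw [huc, zero_sub, neg_sq] at this
    rw [abs_of_nonpos (sub_nonpos.2 h), mul_comm, intervalIntegral.integral_symm, abs_neg, neg_sub]
    exact this.trans (mul_le_mul_of_nonneg_left (le_abs_self _) (sub_nonneg.2 h))

open Filter Topology in
/-- The boundary term `(w' / w) u²` in Jacobi's identity vanishes at an end of the interval where
`w` has a critical point, and at one where both `u` and `w` vanish, `w` to first order. -/
lemma IsH1On.tendsto_logDeriv_mul_sq {a b c : ℝ} {u g w w' : ℝ → ℝ} (hu : IsH1On a b u g)
    (hab : a < b) (hc : c ∈ Set.Icc a b) (hw : HasDerivAt w (w' c) c) (hw' : ContinuousAt w' c)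
    (h : (w c ≠ 0 ∧ w' c = 0) ∨ (w c = 0 ∧ w' c ≠ 0 ∧ u c = 0)) :
    Tendsto (fun x => w' x / w x * u x ^ 2) (𝓝[Set.Ioo a b] c) (𝓝 0) := by
  rcases h with ⟨h0, h1⟩ | ⟨h0, h1, h2⟩
  · have huc : Tendsto u (𝓝[Set.Ioo a b] c) (𝓝 (u c)) := by
      have := hu.continuousOn
      rw [Set.uIcc_of_le hab.le] at this
      exact ((this c hc).mono Set.Ioo_subset_Icc_self).tendsto
    have := ((hw'.div hw.continuousAt h0).tendsto.mono_left
      (nhdsWithin_le_nhds (s := Set.Ioo a b))).mul (huc.pow 2)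
    simpa [h1] using this
  · have hslope : Tendsto (slope w c) (𝓝[≠] c) (𝓝 (w' c)) := hasDerivAt_iff_tendsto_slope.1 hw
    have h3 : ∀ᶠ x in 𝓝[≠] c, w' x / w x * u x ^ 2 =
        w' x * (slope w c x)⁻¹ * (u x ^ 2 / (x - c)) := by
      filter_upwards [self_mem_nhdsWithin] with x hx
      have hxc : x - c ≠ 0 := sub_ne_zero.2 hx
      rw [slope_def_field, h0, sub_zero]
      field_simp
    have h4 : ∀ᶠ x in 𝓝[Set.Ioo a b] c, w' x / w x * u x ^ 2 =
        w' x * (slope w c x)⁻¹ * (u x ^ 2 / (x - c)) := by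
      rw [eventually_nhdsWithin_iff] at h3 ⊢
      filter_upwards [h3] with x hx hxm
      by_cases hxc : x = c
      · simp [hxc, h2]
      · exact hx hxc
    have h5 : Tendsto (slope w c) (𝓝[Set.Ioo a b \ {c}] c) (𝓝 (w' c)) :=
      hslope.mono_left (nhdsWithin_mono _ fun x hx => hx.2)
    have h6 : Tendsto (fun x => w' x * (slope w c x)⁻¹ * (u x ^ 2 / (x - c)))
        (𝓝[Set.Ioo a b \ {c}] c) (𝓝 (w' c * (w' c)⁻¹ * 0)) :=
      ((hw'.tendsto.mono_left nhdsWithin_le_nhds).mul (h5.inv₀ h1)).mul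
        ((hu.tendsto_sq_div hab hc h2).mono_left (nhdsWithin_mono _ Set.sdiff_subset))
    rw [mul_zero] at h6
    refine Tendsto.congr' (h4.mono fun _ h => h.symm) ?_
    intro s hs
    have h7 := h6 hs
    rw [mem_map, mem_nhdsWithin] at h7 ⊢
    obtain ⟨t, ht, hct, hts⟩ := h7
    refine ⟨t, ht, hct, fun x hx => ?_⟩
    by_cases hxc : x = c
    · have := mem_of_mem_nhds hs
      simpa [hxc] using this
    · exact hts ⟨hx.1, hx.2, hxc⟩

lemma IsH1On.form_integrable {a b : ℝ} {u g V : ℝ → ℝ} (hu : IsH1On a b u g)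
    (hV : Continuous V) :
    IntervalIntegrable (fun x => g x ^ 2 + V x * u x ^ 2) volume a b :=
  hu.sq_integrable.add (hV.continuousOn.mul (hu.continuousOn.pow 2)).intervalIntegrable

/-- Jacobi's identity, dropping the square: for a nonvanishing solution `w` of `w'' = V w`, the
integral of `u'² + V u²` exceeds the boundary term by that of `(u' - (w' / w) u)²`. -/
lemma IsH1On.logDeriv_mul_sq_sub_le {a b : ℝ} {u g w w' V : ℝ → ℝ} (hu : IsH1On a b u g)
    (hab : a ≤ b) (hV : Continuous V) (hw : ∀ x, HasDerivAt w (w' x) x)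
    (hw' : ∀ x, HasDerivAt w' (V x * w x) x) (hne : ∀ x ∈ Set.Icc a b, w x ≠ 0) :
    w' b / w b * u b ^ 2 - w' a / w a * u a ^ 2 ≤ ∫ x in a..b, (g x ^ 2 + V x * u x ^ 2) := by
  have hwc : Continuous w := continuous_iff_continuousAt.2 fun x => (hw x).continuousAt
  have hwc' : Continuous w' := continuous_iff_continuousAt.2 fun x => (hw' x).continuousAt
  have hne' : ∀ x ∈ Set.uIcc a b, w x ≠ 0 := by rwa [Set.uIcc_of_le hab]
  have hpc : ContinuousOn (fun x => w' x / w x) (Set.uIcc a b) :=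
    hwc'.continuousOn.div hwc.continuousOn hne'
  have huac : AbsolutelyContinuousOnInterval (fun x => u x * u x) a b :=
    hu.absCont.fun_mul hu.absCont
  have hpd : ∀ x ∈ Set.uIcc a b,
      HasDerivAt (fun x => w' x / w x) (V x - (w' x / w x) ^ 2) x := fun x hx => by
    have := hne' x hx
    refine ((hw' x).div (hw x) this).congr_deriv ?_
    field_simp
  have hpac : AbsolutelyContinuousOnInterval (fun x => w' x / w x) a b := by
    have h1 : ContDiff ℝ 1 w := contDiff_one_iff_deriv.2
      ⟨fun x => (hw x).differentiableAt, by rwa [funext fun x => (hw x).deriv]⟩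
    have h2 : ContDiff ℝ 1 w' := contDiff_one_iff_deriv.2
      ⟨fun x => (hw' x).differentiableAt, by
        rw [funext fun x => (hw' x).deriv]
        exact hV.mul hwc⟩
    exact ContDiffOn.absolutelyContinuousOnInterval (h2.contDiffOn.div h1.contDiffOn hne')
  have hint := (hpac.fun_mul huac).integral_deriv_eq_sub
  have hint' := (hpac.fun_mul huac).intervalIntegrable_deriv
  have e1 : w' b / w b * u b ^ 2 - w' a / w a * u a ^ 2 =
      ∫ x in a..b, deriv (fun x => w' x / w x * (u x * u x)) x := by
    rw [hint]
    ring
  rw [e1]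
  refine intervalIntegral.integral_mono_ae_restrict hab hint' (hu.form_integrable hV) ?_
  refine (ae_restrict_iff' measurableSet_Icc).2 ?_
  filter_upwards [hu.ae_hasDerivAt] with x hx hxm
  rw [← Set.uIcc_of_le hab] at hxm
  have h1 := ((hpd x hxm).mul ((hx hxm).mul (hx hxm))).deriv
  have h2 : deriv (fun x => w' x / w x * (u x * u x)) x =
      (V x - (w' x / w x) ^ 2) * (u x * u x) + w' x / w x * (g x * u x + u x * g x) := h1
  rw [h2]
  nlinarith [sq_nonneg (g x - w' x / w x * u x)]

open Filter Topology in
/-- Jacobi's inequality: if `w'' = V w` and `w` does not vanish inside `[a, b]`, then the form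
`∫ u'² + V u²` is nonnegative on the functions `u` that satisfy at each end the boundary condition
(Neumann or Dirichlet) which `w` satisfies there. -/
lemma IsH1On.form_nonneg {a b : ℝ} {u g w w' V : ℝ → ℝ} (hu : IsH1On a b u g)
    (hab : a < b) (hV : Continuous V) (hw : ∀ x, HasDerivAt w (w' x) x)
    (hw' : ∀ x, HasDerivAt w' (V x * w x) x) (hne : ∀ x ∈ Set.Ioo a b, w x ≠ 0)
    (ha : (w a ≠ 0 ∧ w' a = 0) ∨ (w a = 0 ∧ w' a ≠ 0 ∧ u a = 0))
    (hb : (w b ≠ 0 ∧ w' b = 0) ∨ (w b = 0 ∧ w' b ≠ 0 ∧ u b = 0)) :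
    0 ≤ ∫ x in a..b, (g x ^ 2 + V x * u x ^ 2) := by
  have hI := hu.form_integrable hV
  have hsub : ∀ y z, y ∈ Set.Icc a b → z ∈ Set.Icc a b → Set.uIcc y z ⊆ Set.uIcc a b :=
    fun y z hy hz => by
      rw [Set.uIcc_of_le hab.le]
      exact Set.uIcc_subset_Icc hy hz
  have ham : a ∈ Set.Icc a b := ⟨le_rfl, hab.le⟩
  have hbm : b ∈ Set.Icc a b := ⟨hab.le, le_rfl⟩
  set m := (a + b) / 2 with hm
  have hmm : m ∈ Set.Ioo a b := ⟨by rw [hm]; linarith, by rw [hm]; linarith⟩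
  have hmm' := Set.Ioo_subset_Icc_self hmm
  have hprim : ContinuousOn (fun x => ∫ t in m..x, (g t ^ 2 + V t * u t ^ 2)) (Set.Icc a b) := by
    have := intervalIntegral.continuousOn_primitive_interval' hI
      (by rwa [Set.uIcc_of_le hab.le])
    rwa [Set.uIcc_of_le hab.le] at this
  have hright : 0 - w' m / w m * u m ^ 2 ≤ ∫ t in m..b, (g t ^ 2 + V t * u t ^ 2) := by
    have t1 := (hu.tendsto_logDeriv_mul_sq hab hbm (hw b) (hw' b).continuousAt hb).sub_const
      (w' m / w m * u m ^ 2)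
    have t2 := ((hprim b hbm).mono Set.Ioo_subset_Icc_self).tendsto
    have : (𝓝[Set.Ioo a b] b).NeBot := right_nhdsWithin_Ioo_neBot hab
    refine le_of_tendsto_of_tendsto t1 t2 ?_
    have hev : ∀ᶠ x in 𝓝[Set.Ioo a b] b, m ≤ x :=
      nhdsWithin_le_nhds (Ici_mem_nhds hmm.2)
    filter_upwards [self_mem_nhdsWithin, hev] with x hx hmx
    exact (hu.mono (hsub m x hmm' (Set.Ioo_subset_Icc_self hx))).logDeriv_mul_sq_sub_le hmx hV hw
      hw' fun y hy => hne y ⟨hmm.1.trans_le hy.1, hy.2.trans_lt hx.2⟩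
  have hleft : w' m / w m * u m ^ 2 - 0 ≤ ∫ t in a..m, (g t ^ 2 + V t * u t ^ 2) := by
    have t1 := (hu.tendsto_logDeriv_mul_sq hab ham (hw a) (hw' a).continuousAt ha).const_sub
      (w' m / w m * u m ^ 2)
    have t2 := ((hprim a ham).mono Set.Ioo_subset_Icc_self).neg.tendsto
    rw [intervalIntegral.integral_symm]
    have : (𝓝[Set.Ioo a b] a).NeBot := left_nhdsWithin_Ioo_neBot hab
    refine le_of_tendsto_of_tendsto t1 t2 ?_
    have hev : ∀ᶠ x in 𝓝[Set.Ioo a b] a, x ≤ m :=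
      nhdsWithin_le_nhds (Iic_mem_nhds hmm.1)
    filter_upwards [self_mem_nhdsWithin, hev] with x hx hmx
    rw [Pi.neg_apply, ← intervalIntegral.integral_symm]
    exact (hu.mono (hsub x m (Set.Ioo_subset_Icc_self hx) hmm')).logDeriv_mul_sq_sub_le hmx hV hw
      hw' fun y hy => hne y ⟨hx.1.trans_le hy.1, hy.2.trans_lt hmm.2⟩
  rw [← intervalIntegral.integral_add_adjacent_intervals
    (hI.mono_set (hsub a m ham hmm')) (hI.mono_set (hsub m b hmm' hbm))]
  linarith

namespace DnoidalProfile

variable {L α ν p q : ℝ} {φ φ' : ℝ → ℝ}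

/-! ### Symmetry and monotonicity of the profile -/

section

variable (P : DnoidalProfile L α ν p q φ φ')
include P

lemma p_pos : 0 < p := P.q_pos.trans P.q_lt_p

lemma continuous : Continuous φ :=
  continuous_iff_continuousAt.2 fun x => (P.hasDerivAt x).continuousAt

lemma continuous' : Continuous φ' :=
  continuous_iff_continuousAt.2 fun x => (P.hasDerivAt' x).continuousAt

lemma continuous_potential : Continuous fun x => ν - 3 * φ x ^ 2 / α := by
  have := P.continuous
  fun_prop

lemma deriv_zero : φ' 0 = 0 := by
  have h := P.first_integral 0
  rw [P.apply_zero, sub_self, zero_mul, zero_div] at h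
  exact pow_eq_zero_iff two_ne_zero |>.1 h

lemma apply_period : φ L = φ 0 := by
  simpa using P.periodic 0

lemma deriv_periodic : Function.Periodic φ' L := fun x => by
  have h1 : HasDerivAt (fun x => φ (x + L)) (φ' (x + L)) x :=
    (P.hasDerivAt (x + L)).comp_add_const x L
  rw [funext P.periodic] at h1
  exact h1.unique (P.hasDerivAt x)

lemma deriv_period : φ' L = 0 := by
  have := P.deriv_periodic 0
  rwa [zero_add, P.deriv_zero] at this

lemma reflect (x : ℝ) : φ (L - x) = φ x := by
  rw [sub_eq_neg_add, P.periodic, P.even]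

lemma deriv_reflect (x : ℝ) : φ' (L - x) = -φ' x := by
  have h1 : HasDerivAt (fun x => φ (L - x)) (-φ' (L - x)) x := by
    simpa using (P.hasDerivAt (L - x)).comp_const_sub L x
  rw [funext P.reflect] at h1
  linarith [h1.unique (P.hasDerivAt x)]

lemma strictAntiOn : StrictAntiOn φ (Set.Icc 0 (L / 2)) := by
  refine strictAntiOn_of_deriv_neg (convex_Icc _ _) P.continuous.continuousOn fun x hx => ?_
  rw [interior_Icc] at hx
  rw [(P.hasDerivAt x).deriv]
  exact P.deriv_neg x hx.1 hx.2

/-! ### The second even eigenfunction -/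

lemma hasDerivAt_sq (s x : ℝ) :
    HasDerivAt (fun x => φ x ^ 2 - s) (2 * φ x * φ' x) x :=
  (((P.hasDerivAt x).pow 2).sub_const s).congr_deriv (by simp)

/-- For a root `s` of `3s² - 2(p² + q²)s + p²q²` the function `φ² - s` is an eigenfunction of
`-d²/dx² + ν - 3φ² / α` with eigenvalue `3(s / α - ν)`. -/
lemma hasDerivAt_deriv_sq {s : ℝ} (hs : 3 * s ^ 2 - 2 * (p ^ 2 + q ^ 2) * s + p ^ 2 * q ^ 2 = 0)
    (x : ℝ) :
    HasDerivAt (fun x => 2 * φ x * φ' x)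
      ((ν - 3 * φ x ^ 2 / α - 3 * (s / α - ν)) * (φ x ^ 2 - s)) x := by
  refine (((P.hasDerivAt x).const_mul 2).mul (P.hasDerivAt' x)).congr_deriv ?_
  have hα := P.alpha_pos.ne'
  have h1 := P.first_integral x
  have h2 : ν = (p ^ 2 + q ^ 2) / (2 * α) := by
    rw [P.sum_sq]
    field_simp
  have e : 2 * φ' x * φ' x = 2 * ((p ^ 2 - φ x ^ 2) * (φ x ^ 2 - q ^ 2) / (2 * α)) := by
    rw [← h1]
    ring
  rw [e, h2]
  field_simp
  linear_combination -2 * hs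

/-- The zeros `z` and `L - z` of the second even eigenfunction control the spectrum: on the
functions that vanish at both of them the form of `-d²/dx² + ν - 3φ² / α` is bounded below by a
positive eigenvalue. -/
lemma exists_coercive_of_two_zeros :
    ∃ z l : ℝ, 0 < z ∧ z < L / 2 ∧ 0 < l ∧ ∀ u g : ℝ → ℝ, IsH1On 0 L u g → u z = 0 →
      u (L - z) = 0 → l * ∫ x in (0 : ℝ)..L, u x ^ 2 ≤
        ∫ x in (0 : ℝ)..L, (g x ^ 2 + (ν - 3 * φ x ^ 2 / α) * u x ^ 2) := by
  have hα := P.alpha_pos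
  have hq := P.q_pos
  have hp := P.p_pos
  have hL := P.period_pos
  have hqp : q ^ 2 < p ^ 2 := pow_lt_pow_left₀ P.q_lt_p hq.le two_ne_zero
  obtain ⟨s, ⟨hs1, hs2⟩, hs0⟩ : ∃ s ∈ Set.Ioo ((p ^ 2 + q ^ 2) / 2) (p ^ 2),
      3 * s ^ 2 - 2 * (p ^ 2 + q ^ 2) * s + p ^ 2 * q ^ 2 = 0 := by
    have hc : ContinuousOn (fun s : ℝ => 3 * s ^ 2 - 2 * (p ^ 2 + q ^ 2) * s + p ^ 2 * q ^ 2)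
        (Set.Icc ((p ^ 2 + q ^ 2) / 2) (p ^ 2)) := by fun_prop
    refine intermediate_value_Ioo (by linarith) hc ⟨?_, ?_⟩
    · nlinarith [sq_pos_of_pos (sub_pos.2 hqp)]
    · nlinarith [mul_pos (pow_pos hp 2) (sub_pos.2 hqp)]
  obtain ⟨z, ⟨hz0, hz1⟩, hz⟩ : ∃ z ∈ Set.Ioo 0 (L / 2), φ z ^ 2 = s := by
    refine intermediate_value_Ioo' (by linarith) (P.continuous.pow 2).continuousOn ⟨?_, ?_⟩
    · rw [Pi.pow_apply, P.apply_half]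
      linarith
    · rw [Pi.pow_apply, P.apply_zero]
      exact hs2
  have hl : 0 < 3 * (s / α - ν) := by
    have : ν < s / α := by
      rw [lt_div_iff₀ hα]
      linarith [P.sum_sq]
    linarith
  refine ⟨z, 3 * (s / α - ν), hz0, hz1, hl, fun u g hu huz huz' => ?_⟩
  have hVc : Continuous fun x => ν - 3 * φ x ^ 2 / α - 3 * (s / α - ν) :=
    P.continuous_potential.sub continuous_const
  have hlt : ∀ x y, x ∈ Set.Icc 0 (L / 2) → y ∈ Set.Icc 0 (L / 2) → x < y →
      φ y ^ 2 < φ x ^ 2 := fun x y hx hy hxy =>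
    pow_lt_pow_left₀ (P.strictAntiOn hx hy hxy) (P.pos y).le two_ne_zero
  have hzm : z ∈ Set.Icc 0 (L / 2) := ⟨hz0.le, hz1.le⟩
  have hz'1 : φ (L - z) ^ 2 - s = 0 := by rw [P.reflect, hz, sub_self]
  have hdz : 2 * φ z * φ' z ≠ 0 := mul_ne_zero (mul_ne_zero two_ne_zero (P.pos z).ne')
    (P.deriv_neg z hz0 hz1).ne
  have hdz' : 2 * φ (L - z) * φ' (L - z) ≠ 0 := by
    rw [P.reflect, P.deriv_reflect, mul_neg]
    exact neg_ne_zero.2 hdz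
  have hends : φ 0 ^ 2 - s ≠ 0 := by
    rw [P.apply_zero]
    linarith
  have hsub : ∀ a b, 0 ≤ a → a ≤ b → b ≤ L → Set.uIcc a b ⊆ Set.uIcc 0 L :=
    fun a b h0 h1 h2 => by
      rw [Set.uIcc_of_le hL.le, Set.uIcc_of_le h1]
      exact Set.Icc_subset_Icc h0 h2
  have u1 := hu.mono (hsub 0 z le_rfl hz0.le (by linarith))
  have u2 := hu.mono (hsub z (L - z) hz0.le (by linarith) (by linarith))
  have u3 := hu.mono (hsub (L - z) L (by linarith) (by linarith) le_rfl)
  have hleft : ∀ x, 0 ≤ x → x < z → φ x ^ 2 - s ≠ 0 := fun x h0 h1 => by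
    have := hlt x z ⟨h0, by linarith⟩ hzm h1
    linarith
  have hmid : ∀ x, z < x → x ≤ L / 2 → φ x ^ 2 - s ≠ 0 := fun x h0 h1 => by
    have := hlt z x hzm ⟨by linarith, h1⟩ h0
    linarith
  have i1 := u1.form_nonneg hz0 hVc (P.hasDerivAt_sq s) (P.hasDerivAt_deriv_sq hs0)
    (fun x hx => hleft x hx.1.le hx.2) (Or.inl ⟨hends, by simp [P.deriv_zero]⟩)
    (Or.inr ⟨by linarith, hdz, huz⟩)
  have i2 := u2.form_nonneg (by linarith) hVc (P.hasDerivAt_sq s) (P.hasDerivAt_deriv_sq hs0)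
    (fun x hx => by
      rcases le_total x (L / 2) with h | h
      · exact hmid x hx.1 h
      · rw [← P.reflect]
        exact hmid (L - x) (by linarith [hx.2]) (by linarith))
    (Or.inr ⟨by linarith, hdz, huz⟩) (Or.inr ⟨hz'1, hdz', huz'⟩)
  have i3 := u3.form_nonneg (by linarith) hVc (P.hasDerivAt_sq s) (P.hasDerivAt_deriv_sq hs0)
    (fun x hx => by
      rw [← P.reflect]
      exact hleft (L - x) (by linarith [hx.2]) (by linarith [hx.1]))
    (Or.inr ⟨hz'1, hdz', huz'⟩)
    (Or.inl ⟨by rwa [P.apply_period], by simp [P.deriv_period]⟩)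
  have hsum : 0 ≤ ∫ x in (0 : ℝ)..L,
      (g x ^ 2 + (ν - 3 * φ x ^ 2 / α - 3 * (s / α - ν)) * u x ^ 2) := by
    rw [← intervalIntegral.integral_add_adjacent_intervals
        (u1.form_integrable hVc) ((u2.form_integrable hVc).trans (u3.form_integrable hVc)),
      ← intervalIntegral.integral_add_adjacent_intervals
        (u2.form_integrable hVc) (u3.form_integrable hVc)]
    linarith
  have e : ∀ x, g x ^ 2 + (ν - 3 * φ x ^ 2 / α - 3 * (s / α - ν)) * u x ^ 2 =
      (g x ^ 2 + (ν - 3 * φ x ^ 2 / α) * u x ^ 2) - 3 * (s / α - ν) * u x ^ 2 := fun x => by ring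
  simp_rw [e] at hsum
  have hu2 : IntervalIntegrable (fun x => u x ^ 2) volume 0 L :=
    (hu.continuousOn.pow 2).intervalIntegrable
  rw [intervalIntegral.integral_sub (hu.form_integrable P.continuous_potential)
    (hu2.const_mul _),
    intervalIntegral.integral_const_mul] at hsum
  linarith

/-! ### The inverse image of the profile -/

/-- The mean of `φ²` exceeds the geometric mean of its extreme values `p²` and `q²`. -/
lemma mul_mul_lt_integral_sq : p * q * L < ∫ x in (0 : ℝ)..L, φ x ^ 2 := by
  have hα := P.alpha_pos.ne'
  have hc := P.continuous
  have hne : ∀ x, φ x ≠ 0 := fun x => (P.pos x).ne'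
  have hci : Continuous fun x => (φ x)⁻¹ := hc.inv₀ hne
  -- Integrating `(log φ)''` over a period shows that `φ` and `pq / φ` have the same norm.
  have hd : ∀ x, HasDerivAt (fun x => φ' x / φ x)
      ((2 * α)⁻¹ * ((p * q * (φ x)⁻¹) ^ 2 - φ x ^ 2)) x := fun x => by
    have := hne x
    refine ((P.hasDerivAt' x).div (P.hasDerivAt x) this).congr_deriv ?_
    have h2 : ν = (p ^ 2 + q ^ 2) / (2 * α) := by
      rw [P.sum_sq]
      field_simp
    have e : φ' x * φ' x = (p ^ 2 - φ x ^ 2) * (φ x ^ 2 - q ^ 2) / (2 * α) := by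
      rw [← P.first_integral x]
      ring
    rw [e, h2]
    field_simp
    ring
  have hint := intervalIntegral.integral_eq_sub_of_hasDerivAt (a := 0) (b := L)
    (fun x _ => hd x) (Continuous.intervalIntegrable (by fun_prop) _ _)
  have c1 : Continuous fun x => (p * q * (φ x)⁻¹) ^ 2 := by fun_prop
  have c2 : Continuous fun x => φ x ^ 2 := by fun_prop
  rw [P.deriv_zero, P.deriv_period, zero_div, zero_div, sub_self,
    intervalIntegral.integral_const_mul,
    intervalIntegral.integral_sub (c1.intervalIntegrable _ _) (c2.intervalIntegrable _ _)] at hint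
  have hint' : ∫ x in (0 : ℝ)..L, (p * q * (φ x)⁻¹) ^ 2 = ∫ x in (0 : ℝ)..L, φ x ^ 2 := by
    have := (mul_eq_zero.1 hint).resolve_left (inv_ne_zero (mul_ne_zero two_ne_zero hα))
    linarith
  have hpos : 0 < ∫ x in (0 : ℝ)..L, (φ x - p * q * (φ x)⁻¹) ^ 2 := by
    refine intervalIntegral.integral_pos P.period_pos (by fun_prop) (fun x _ => sq_nonneg _)
      ⟨0, ⟨le_rfl, P.period_pos.le⟩, ?_⟩
    have h1 : p - p * q * p⁻¹ = p - q := by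
      have := P.p_pos
      field_simp
    rw [P.apply_zero, h1]
    exact pow_pos (sub_pos.2 P.q_lt_p) 2
  have e : ∀ x, (φ x - p * q * (φ x)⁻¹) ^ 2 =
      φ x ^ 2 + (p * q * (φ x)⁻¹) ^ 2 - 2 * (p * q) := fun x => by
    have := hne x
    field_simp
    ring
  simp_rw [e] at hpos
  rw [intervalIntegral.integral_sub ((c1.add c2).intervalIntegrable _ _ |>.congr fun x _ =>
      add_comm _ _) (by simp),
    intervalIntegral.integral_add (c2.intervalIntegrable _ _) (c1.intervalIntegrable _ _),
    hint', intervalIntegral.integral_const, smul_eq_mul, sub_zero] at hpos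
  linarith

/-- The equation `-χ'' + (ν - 3φ² / α) χ = φ` has a periodic solution, symmetric about the half
period, with `∫ χ φ < 0`. It is a multiple of `φ³ - (p² + q² - M) φ - φ' I`, where `M` is the mean
of `φ²` and `I(x) = ∫₀ˣ (φ² - M)`. -/
lemma exists_periodic_solution :
    ∃ χ χ' : ℝ → ℝ, (∀ x, HasDerivAt χ (χ' x) x) ∧
      (∀ x, HasDerivAt χ' ((ν - 3 * φ x ^ 2 / α) * χ x - φ x) x) ∧
      (∀ x, χ (L - x) = χ x) ∧ χ L = χ 0 ∧ χ' L = χ' 0 ∧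
      ∫ x in (0 : ℝ)..L, χ x * φ x < 0 := by
  have hα0 := P.alpha_pos
  have hα := hα0.ne'
  have hL := P.period_pos
  have hc := P.continuous
  have hpq : 0 < p * q := mul_pos P.p_pos P.q_pos
  have hν : ν = (p ^ 2 + q ^ 2) / (2 * α) := by
    rw [P.sum_sq]
    field_simp
  set M : ℝ := (∫ x in (0 : ℝ)..L, φ x ^ 2) / L with hM
  have hML : ∫ x in (0 : ℝ)..L, φ x ^ 2 = M * L := by
    rw [hM]
    field_simp
  have hMpq : p * q < M := by
    rw [hM, lt_div_iff₀ hL]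
    exact P.mul_mul_lt_integral_sq
  set I : ℝ → ℝ := fun x => (∫ t in (0 : ℝ)..x, φ t ^ 2) - M * x with hI
  have hId : ∀ x, HasDerivAt I (φ x ^ 2 - M) x := fun x => by
    have h1 : HasDerivAt (fun x => ∫ t in (0 : ℝ)..x, φ t ^ 2) (φ x ^ 2) x :=
      ((hc.pow 2).integral_hasStrictDerivAt 0 x).hasDerivAt
    exact (h1.sub ((hasDerivAt_id x).const_mul M)).congr_deriv (by simp)
  have hI0 : I 0 = 0 := by simp [hI]
  have hIL : I L = 0 := by simp [hI, hML]
  have hIr : ∀ x, I (L - x) = -I x := fun x => by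
    have h1 := intervalIntegral.integral_comp_sub_left (a := 0) (b := x) (fun t => φ t ^ 2) L
    simp only [P.reflect, sub_zero] at h1
    have h2 := intervalIntegral.integral_add_adjacent_intervals
      ((hc.pow 2).intervalIntegrable (μ := volume) 0 (L - x))
      ((hc.pow 2).intervalIntegrable (μ := volume) (L - x) L)
    simp only [Pi.pow_apply] at h2
    simp only [hI]
    linarith
  set D : ℝ := ((p ^ 2 + q ^ 2) * M - 2 * p ^ 2 * q ^ 2) / α with hD
  have hD0 : 0 < D := by
    refine div_pos ?_ hα0
    nlinarith [mul_nonneg (sq_nonneg (p - q)) (hpq.trans hMpq).le]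
  set X : ℝ → ℝ := fun x => φ x ^ 3 - (p ^ 2 + q ^ 2 - M) * φ x - φ' x * I x with hX
  set X' : ℝ → ℝ := fun x => 3 * φ x ^ 2 * φ' x - (p ^ 2 + q ^ 2 - M) * φ' x -
    ((ν * φ x - φ x ^ 3 / α) * I x + φ' x * (φ x ^ 2 - M)) with hX'
  have hXd : ∀ x, HasDerivAt X (X' x) x := fun x => by
    refine ((((P.hasDerivAt x).pow 3).sub ((P.hasDerivAt x).const_mul _)).sub
      ((P.hasDerivAt' x).mul (hId x))).congr_deriv ?_
    simp [hX']
  have hXd' : ∀ x, HasDerivAt X' ((ν - 3 * φ x ^ 2 / α) * X x + D * φ x) x := fun x => by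
    have d1 := P.hasDerivAt x
    have d2 := P.hasDerivAt' x
    have d3 := ((d1.const_mul ν).sub ((d1.pow 3).div_const α)).mul (hId x)
    have d4 := d2.mul ((d1.pow 2).sub_const M)
    refine (((((d1.pow 2).const_mul 3).mul d2).sub (d2.const_mul _)).sub
      (d3.add d4)).congr_deriv ?_
    have h1 := P.first_integral x
    simp only [hX, hD, Nat.add_one_sub_one, Nat.cast_ofNat, pow_one, Pi.pow_apply, Pi.sub_apply,
      hν]
    field_simp at h1 ⊢
    linear_combination (4 * φ x) * h1
  have hint : ∫ x in (0 : ℝ)..L, X x * φ x = L / 2 * (M ^ 2 - p ^ 2 * q ^ 2) := by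
    have hG : ∀ x, HasDerivAt
        (fun x => M * I x / 2 - α * (φ x * φ' x) - φ x ^ 2 * I x / 2 +
          (M ^ 2 - p ^ 2 * q ^ 2) / 2 * x) (X x * φ x) x := fun x => by
      have d1 := P.hasDerivAt x
      have d2 := P.hasDerivAt' x
      refine ((((((hId x).const_mul M).div_const 2).sub ((d1.mul d2).const_mul α)).sub
        (((d1.pow 2).mul (hId x)).div_const 2)).add
          ((hasDerivAt_id x).const_mul _)).congr_deriv ?_
      have h1 := P.first_integral x
      simp only [hX, Nat.add_one_sub_one, Nat.cast_ofNat, pow_one, Pi.pow_apply, hν]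
      field_simp at h1 ⊢
      linear_combination -h1
    have hXc : Continuous X := continuous_iff_continuousAt.2 fun x => (hXd x).continuousAt
    rw [intervalIntegral.integral_eq_sub_of_hasDerivAt (fun x _ => hG x)
      ((hXc.mul hc).intervalIntegrable _ _)]
    simp only [hI0, hIL, P.deriv_zero, P.deriv_period]
    ring
  refine ⟨fun x => -D⁻¹ * X x, fun x => -D⁻¹ * X' x, fun x => (hXd x).const_mul _,
    fun x => ((hXd' x).const_mul _).congr_deriv ?_, fun x => ?_, ?_, ?_, ?_⟩
  · field_simp
    ring
  · simp only [hX, P.reflect, P.deriv_reflect, hIr, neg_mul_neg]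
  · simp only [hX, P.apply_period, hI0, hIL]
    simp
  · simp only [hX', P.apply_period, P.deriv_period, P.deriv_zero, hI0, hIL]
  · have e : ∀ x, -D⁻¹ * X x * φ x = -D⁻¹ * (X x * φ x) := fun x => by ring
    simp_rw [e]
    rw [intervalIntegral.integral_const_mul, hint]
    have h1 : 0 < M ^ 2 - p ^ 2 * q ^ 2 := by nlinarith
    have : 0 < D⁻¹ * (L / 2 * (M ^ 2 - p ^ 2 * q ^ 2)) := by positivity
    linarith

end

end DnoidalProfile

/-! ### Coercivity on the orthogonal complement of the profile -/

lemma sq_integral_mul_le {a b : ℝ} (hab : a ≤ b) {v w : ℝ → ℝ}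
    (hv : ContinuousOn v (Set.uIcc a b)) (hw : ContinuousOn w (Set.uIcc a b)) :
    (∫ x in a..b, v x * w x) ^ 2 ≤ (∫ x in a..b, v x ^ 2) * ∫ x in a..b, w x ^ 2 := by
  have i1 : IntervalIntegrable (fun x => v x ^ 2) volume a b := (hv.pow 2).intervalIntegrable
  have i2 : IntervalIntegrable (fun x => w x ^ 2) volume a b := (hw.pow 2).intervalIntegrable
  have i3 : IntervalIntegrable (fun x => v x * w x) volume a b := (hv.mul hw).intervalIntegrable
  have h : ∀ r : ℝ, 0 ≤ (∫ x in a..b, w x ^ 2) * (r * r) + (2 * ∫ x in a..b, v x * w x) * r +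
      ∫ x in a..b, v x ^ 2 := fun r => by
    have h0 : 0 ≤ ∫ x in a..b, (v x + r * w x) ^ 2 :=
      intervalIntegral.integral_nonneg hab fun x _ => sq_nonneg _
    have e : ∀ x, (v x + r * w x) ^ 2 = v x ^ 2 + 2 * r * (v x * w x) + r ^ 2 * w x ^ 2 :=
      fun x => by ring
    simp_rw [e] at h0
    rw [intervalIntegral.integral_add (i1.add (i3.const_mul _)) (i2.const_mul _),
      intervalIntegral.integral_add i1 (i3.const_mul _), intervalIntegral.integral_const_mul,
      intervalIntegral.integral_const_mul] at h0
    linarith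
  have := discrim_le_zero h
  rw [discrim] at this
  linarith

/-- If `h` is a periodic solution of `-h'' + V h = ρ`, then `(u, h) ↦ ∫ u' h' + V u h` reduces to
`∫ u ρ`. -/
lemma IsH1On.integral_form_eq {L : ℝ} {u g V h h' ρ : ℝ → ℝ} (hu : IsH1On 0 L u g)
    (huL : u L = u 0) (hV : Continuous V) (hρ : Continuous ρ) (hh : ∀ x, HasDerivAt h (h' x) x)
    (hh' : ∀ x, HasDerivAt h' (V x * h x - ρ x) x) (hL' : h' L = h' 0) :
    ∫ x in (0 : ℝ)..L, (g x * h' x + V x * u x * h x) = ∫ x in (0 : ℝ)..L, u x * ρ x := by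
  have hc : Continuous h := continuous_iff_continuousAt.2 fun x => (hh x).continuousAt
  have hc' : Continuous h' := continuous_iff_continuousAt.2 fun x => (hh' x).continuousAt
  have hc'' : Continuous fun x => V x * h x - ρ x := by fun_prop
  have h1 := hu.integral_mul_add (IsH1On.of_hasDerivAt hh' hc'')
  rw [huL, hL', sub_self] at h1
  have e : ∀ x, g x * h' x + V x * u x * h x =
      (g x * h' x + u x * (V x * h x - ρ x)) + u x * ρ x := fun x => by ring
  simp_rw [e]
  rw [intervalIntegral.integral_add ((hu.mul_integrable hc'.continuousOn).add
    (hu.mul_continuousOn_integrable hc''.continuousOn))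
    (hu.mul_continuousOn_integrable hρ.continuousOn), h1, zero_add]

lemma IsH1On.integral_form_sub {L : ℝ} {u g V h h' ρ : ℝ → ℝ} (hu : IsH1On 0 L u g)
    (huL : u L = u 0) (hV : Continuous V) (hρ : Continuous ρ) (hh : ∀ x, HasDerivAt h (h' x) x)
    (hh' : ∀ x, HasDerivAt h' (V x * h x - ρ x) x) (hL : h L = h 0) (hL' : h' L = h' 0) :
    ∫ x in (0 : ℝ)..L, ((g x - h' x) ^ 2 + V x * (u x - h x) ^ 2) =
      (∫ x in (0 : ℝ)..L, (g x ^ 2 + V x * u x ^ 2)) - 2 * (∫ x in (0 : ℝ)..L, u x * ρ x) +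
        ∫ x in (0 : ℝ)..L, h x * ρ x := by
  have hc : Continuous h := continuous_iff_continuousAt.2 fun x => (hh x).continuousAt
  have hc' : Continuous h' := continuous_iff_continuousAt.2 fun x => (hh' x).continuousAt
  have hhH := IsH1On.of_hasDerivAt (a := 0) (b := L) hh hc'
  have i1 : IntervalIntegrable (fun x => g x * h' x + V x * u x * h x) volume 0 L :=
    (hu.mul_integrable hc'.continuousOn).add
      ((hV.continuousOn.mul hu.continuousOn).mul hc.continuousOn).intervalIntegrable
  have i2 : IntervalIntegrable (fun x => h' x * h' x + V x * h x * h x) volume 0 L :=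
    Continuous.intervalIntegrable (by fun_prop) _ _
  rw [← hu.integral_form_eq huL hV hρ hh hh' hL', ← hhH.integral_form_eq hL hV hρ hh hh' hL',
    ← intervalIntegral.integral_const_mul, ← intervalIntegral.integral_sub
      (hu.form_integrable hV) (i1.const_mul 2),
    ← intervalIntegral.integral_add ((hu.form_integrable hV).sub (i1.const_mul 2)) i2]
  refine intervalIntegral.integral_congr fun x _ => ?_
  ring

namespace DnoidalProfile

variable {L α ν p q : ℝ} {φ φ' : ℝ → ℝ}

section

variable (P : DnoidalProfile L α ν p q φ φ')
include P

lemma continuous_deriv_deriv : Continuous fun x => ν * φ x - φ x ^ 3 / α := by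
  have := P.continuous
  fun_prop

/-- The derivative of the profile lies in the kernel of `-d²/dx² + ν - 3φ² / α`. -/
lemma hasDerivAt_deriv_deriv (x : ℝ) :
    HasDerivAt (fun x => ν * φ x - φ x ^ 3 / α) ((ν - 3 * φ x ^ 2 / α) * φ' x - 0) x := by
  refine (((P.hasDerivAt x).const_mul ν).sub (((P.hasDerivAt x).pow 3).div_const α)).congr_deriv ?_
  simp only [Nat.add_one_sub_one, Nat.cast_ofNat]
  ring

lemma integral_form_deriv_eq_zero :
    ∫ x in (0 : ℝ)..L, ((ν * φ x - φ x ^ 3 / α) ^ 2 + (ν - 3 * φ x ^ 2 / α) * φ' x ^ 2) = 0 := by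
  have hH : IsH1On 0 L φ' _ := IsH1On.of_hasDerivAt P.hasDerivAt' P.continuous_deriv_deriv
  have h := hH.integral_form_eq (by rw [P.deriv_period, P.deriv_zero]) P.continuous_potential
    continuous_const P.hasDerivAt' P.hasDerivAt_deriv_deriv (by rw [P.apply_period])
  simp only [mul_zero, intervalIntegral.integral_zero] at h
  refine Eq.trans ?_ h
  refine intervalIntegral.integral_congr fun x _ => ?_
  ring

lemma integral_deriv_mul_pow (n : ℕ) : ∫ x in (0 : ℝ)..L, φ' x * φ x ^ n = 0 := by
  have hd : ∀ x, HasDerivAt (fun x => φ x ^ (n + 1) / (n + 1)) (φ' x * φ x ^ n) x := fun x => by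
    refine (((P.hasDerivAt x).pow (n + 1)).div_const _).congr_deriv ?_
    have : (n : ℝ) + 1 ≠ 0 := by positivity
    simp only [Nat.add_one_sub_one, Nat.cast_add, Nat.cast_one]
    field_simp
  rw [intervalIntegral.integral_eq_sub_of_hasDerivAt (fun x _ => hd x)
    ((P.continuous'.mul (P.continuous.pow n)).intervalIntegrable _ _), P.apply_period, sub_self]

/-- A function orthogonal to `φ` is split, with the solution `χ` of `-χ'' + (ν - 3φ² / α) χ = φ` and
the kernel element `φ'`, as `u = v + tχ + sφ'` where `v` vanishes at both zeros of the second even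
eigenfunction. The form of `u` then dominates both `v` and the coefficient `t`. -/
lemma exists_decomposition :
    ∃ (l m : ℝ) (χ : ℝ → ℝ), 0 < l ∧ 0 < m ∧ Continuous χ ∧ ∀ u g : ℝ → ℝ, IsH1On 0 L u g →
      u L = u 0 → ∫ x in (0 : ℝ)..L, u x * φ x = 0 →
      ∃ (t s : ℝ) (v : ℝ → ℝ), ContinuousOn v (Set.uIcc 0 L) ∧
        (∀ x, u x = v x + t * χ x + s * φ' x) ∧
        l * (∫ x in (0 : ℝ)..L, v x ^ 2) + m * t ^ 2 ≤
          ∫ x in (0 : ℝ)..L, (g x ^ 2 + (ν - 3 * φ x ^ 2 / α) * u x ^ 2) := by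
  obtain ⟨z, l, hz0, hz1, hl, hco⟩ := P.exists_coercive_of_two_zeros
  obtain ⟨χ, χ', hχ, hχ', hr, hL, hL', hneg⟩ := P.exists_periodic_solution
  have hcχ : Continuous χ := continuous_iff_continuousAt.2 fun x => (hχ x).continuousAt
  have hcχ' : Continuous χ' := continuous_iff_continuousAt.2 fun x => (hχ' x).continuousAt
  have hχz : χ z ≠ 0 := fun h0 => by
    -- Otherwise the form would be nonnegative at `χ`, where its value is `∫ χ φ < 0`.
    have hH := IsH1On.of_hasDerivAt (a := 0) (b := L) hχ hcχ'
    have h1 := hco χ χ' hH h0 (by rw [hr, h0])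
    have h2 := hH.integral_form_eq hL P.continuous_potential P.continuous hχ hχ' hL'
    have h3 : 0 ≤ ∫ x in (0 : ℝ)..L, χ x ^ 2 :=
      intervalIntegral.integral_nonneg P.period_pos.le fun x _ => sq_nonneg _
    have h4 : ∫ x in (0 : ℝ)..L, (χ' x ^ 2 + (ν - 3 * φ x ^ 2 / α) * χ x ^ 2) =
        ∫ x in (0 : ℝ)..L, (χ' x * χ' x + (ν - 3 * φ x ^ 2 / α) * χ x * χ x) :=
      intervalIntegral.integral_congr fun x _ => by ring
    have h5 := mul_nonneg hl.le h3
    linarith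
  have hφz : φ' z ≠ 0 := (P.deriv_neg z hz0 hz1).ne
  refine ⟨l, -∫ x in (0 : ℝ)..L, χ x * φ x, χ, hl, by linarith, hcχ, fun u g hu huL huφ => ?_⟩
  set t : ℝ := (u z + u (L - z)) / (2 * χ z) with ht
  set s : ℝ := (u z - u (L - z)) / (2 * φ' z) with hs
  set h : ℝ → ℝ := fun x => t * χ x + s * φ' x with hh
  set h' : ℝ → ℝ := fun x => t * χ' x + s * (ν * φ x - φ x ^ 3 / α) with hh'
  have hd : ∀ x, HasDerivAt h (h' x) x := fun x =>
    ((hχ x).const_mul t).add ((P.hasDerivAt' x).const_mul s)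
  have hd' : ∀ x, HasDerivAt h' ((ν - 3 * φ x ^ 2 / α) * h x - t * φ x) x := fun x =>
    (((hχ' x).const_mul t).add ((P.hasDerivAt_deriv_deriv x).const_mul s)).congr_deriv
      (by simp only [hh]; ring)
  have hch' : Continuous h' := by
    have := P.continuous_deriv_deriv
    fun_prop
  have hv := hu.sub hd hch'
  refine ⟨t, s, fun x => u x - h x, hv.continuousOn, fun x => by simp only [hh]; ring, ?_⟩
  have h1 := hco _ _ hv
    (by simp only [hh, ht, hs]; field_simp; ring)
    (by simp only [hh, ht, hs, hr, P.deriv_reflect]; field_simp; ring)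
  have h2 := hu.integral_form_sub (ρ := fun x => t * φ x) huL P.continuous_potential
    (continuous_const.mul P.continuous)
    hd hd' (by simp only [hh, hL, P.deriv_period, P.deriv_zero])
    (by simp only [hh', hL', P.apply_period])
  have h3 : ∫ x in (0 : ℝ)..L, u x * (t * φ x) = 0 := by
    have e : ∀ x, u x * (t * φ x) = t * (u x * φ x) := fun x => by ring
    simp_rw [e]
    rw [intervalIntegral.integral_const_mul, huφ, mul_zero]
  have h4 : ∫ x in (0 : ℝ)..L, h x * (t * φ x) = t ^ 2 * ∫ x in (0 : ℝ)..L, χ x * φ x := by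
    have e : ∀ x, h x * (t * φ x) = t ^ 2 * (χ x * φ x) + t * s * (φ' x * φ x ^ 1) :=
      fun x => by simp only [hh]; ring
    simp_rw [e]
    have i1 : IntervalIntegrable (fun x => χ x * φ x) volume 0 L :=
      (hcχ.mul P.continuous).intervalIntegrable _ _
    have i2 : IntervalIntegrable (fun x => φ' x * φ x ^ 1) volume 0 L :=
      (P.continuous'.mul (P.continuous.pow 1)).intervalIntegrable _ _
    rw [intervalIntegral.integral_add (i1.const_mul _) (i2.const_mul _),
      intervalIntegral.integral_const_mul, intervalIntegral.integral_const_mul,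
      P.integral_deriv_mul_pow, mul_zero, add_zero]
  rw [h2, h3, h4] at h1
  linarith

lemma form_nonneg {u g : ℝ → ℝ} (hu : IsH1On 0 L u g) (huL : u L = u 0)
    (huφ : ∫ x in (0 : ℝ)..L, u x * φ x = 0) :
    0 ≤ ∫ x in (0 : ℝ)..L, (g x ^ 2 + (ν - 3 * φ x ^ 2 / α) * u x ^ 2) := by
  obtain ⟨l, m, χ, hl, hm, -, H⟩ := P.exists_decomposition
  obtain ⟨t, s, v, -, -, h⟩ := H u g hu huL huφ
  have h3 : 0 ≤ ∫ x in (0 : ℝ)..L, v x ^ 2 :=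
    intervalIntegral.integral_nonneg P.period_pos.le fun x _ => sq_nonneg _
  refine le_trans ?_ h
  positivity

/-- Orthogonality to `φ² φ'`, which is not orthogonal to the kernel element `φ'`, makes the form
strictly coercive: it bounds the component along `φ'` by the other two components. -/
lemma exists_coercive :
    ∃ δ : ℝ, 0 < δ ∧ ∀ u g : ℝ → ℝ, IsH1On 0 L u g → u L = u 0 →
      ∫ x in (0 : ℝ)..L, u x * φ x = 0 → ∫ x in (0 : ℝ)..L, u x * (φ' x * φ x ^ 2) = 0 →
      δ * ∫ x in (0 : ℝ)..L, u x ^ 2 ≤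
        ∫ x in (0 : ℝ)..L, (g x ^ 2 + (ν - 3 * φ x ^ 2 / α) * u x ^ 2) := by
  obtain ⟨l, m, χ, hl, hm, hχ, H⟩ := P.exists_decomposition
  have hL := P.period_pos
  have hc := P.continuous
  have hc' := P.continuous'
  set N := ∫ x in (0 : ℝ)..L, φ' x * (φ' x * φ x ^ 2) with hN
  have hN0 : 0 < N := by
    have e : ∀ x, φ' x * (φ' x * φ x ^ 2) = (φ' x * φ x) ^ 2 := fun x => by ring
    simp_rw [hN, e]
    refine intervalIntegral.integral_pos hL (by fun_prop) (fun x _ => sq_nonneg _)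
      ⟨L / 4, ⟨by linarith, by linarith⟩, ?_⟩
    have h1 := (P.deriv_neg (L / 4) (by linarith) (by linarith)).ne
    have h2 := (P.pos (L / 4)).ne'
    positivity
  set B := ∫ x in (0 : ℝ)..L, (φ' x * φ x ^ 2) ^ 2 with hB
  set a := ∫ x in (0 : ℝ)..L, χ x * (φ' x * φ x ^ 2) with ha
  set c₁ := ∫ x in (0 : ℝ)..L, χ x ^ 2 with hc₁
  set c₂ := ∫ x in (0 : ℝ)..L, φ' x ^ 2 with hc₂
  have hB0 : 0 ≤ B := intervalIntegral.integral_nonneg hL.le fun x _ => sq_nonneg _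
  have hc₁0 : 0 ≤ c₁ := intervalIntegral.integral_nonneg hL.le fun x _ => sq_nonneg _
  have hc₂0 : 0 ≤ c₂ := intervalIntegral.integral_nonneg hL.le fun x _ => sq_nonneg _
  set C₁ := 3 * (1 + c₂ * (2 * B / N ^ 2)) with hC₁
  set C₂ := 3 * (c₁ + c₂ * (2 * a ^ 2 / N ^ 2)) with hC₂
  have hC₁0 : 0 < C₁ := by positivity
  have hC₂0 : 0 ≤ C₂ := by positivity
  refine ⟨min (l / C₁) (m / (C₂ + 1)), lt_min (by positivity) (by positivity),
    fun u g hu huL huφ huκ => ?_⟩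
  obtain ⟨t, s, v, hvc, huv, hform⟩ := H u g hu huL huφ
  set W := ∫ x in (0 : ℝ)..L, v x ^ 2 with hW
  have hW0 : 0 ≤ W := intervalIntegral.integral_nonneg hL.le fun x _ => sq_nonneg _
  have hκc : Continuous fun x => φ' x * φ x ^ 2 := by fun_prop
  have hs : (∫ x in (0 : ℝ)..L, v x * (φ' x * φ x ^ 2)) + t * a + s * N = 0 := by
    have e : ∀ x, u x * (φ' x * φ x ^ 2) = v x * (φ' x * φ x ^ 2) +
        t * (χ x * (φ' x * φ x ^ 2)) + s * (φ' x * (φ' x * φ x ^ 2)) := fun x => by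
      rw [huv]
      ring
    have i1 := (hvc.mul hκc.continuousOn).intervalIntegrable (μ := volume)
    have i2 := ((hχ.mul hκc).intervalIntegrable (μ := volume) 0 L).const_mul t
    have i3 := ((hc'.mul hκc).intervalIntegrable (μ := volume) 0 L).const_mul s
    simp_rw [e] at huκ
    simp only [Pi.mul_def] at i1 i2 i3
    rwa [intervalIntegral.integral_add (i1.add i2) i3, intervalIntegral.integral_add i1 i2,
      intervalIntegral.integral_const_mul, intervalIntegral.integral_const_mul] at huκ
  have hcs := sq_integral_mul_le hL.le hvc hκc.continuousOn
  set J := ∫ x in (0 : ℝ)..L, v x * (φ' x * φ x ^ 2) with hJ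
  have hs2 : s ^ 2 ≤ 2 * B / N ^ 2 * W + 2 * a ^ 2 / N ^ 2 * t ^ 2 := by
    have h1 : s ^ 2 * N ^ 2 ≤ 2 * B * W + 2 * a ^ 2 * t ^ 2 := by
      have h2 : s * N = -(J + t * a) := by linarith
      have h3 : s ^ 2 * N ^ 2 = (J + t * a) ^ 2 := by rw [← mul_pow, h2, neg_sq]
      rw [h3]
      nlinarith [sq_nonneg (J - t * a)]
    have h4 : 2 * B / N ^ 2 * W + 2 * a ^ 2 / N ^ 2 * t ^ 2 =
        (2 * B * W + 2 * a ^ 2 * t ^ 2) / N ^ 2 := by ring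
    rw [h4, le_div_iff₀ (by positivity)]
    exact h1
  have hu2 : ∫ x in (0 : ℝ)..L, u x ^ 2 ≤ 3 * (W + t ^ 2 * c₁ + s ^ 2 * c₂) := by
    have i1 : IntervalIntegrable (fun x => v x ^ 2) volume 0 L := (hvc.pow 2).intervalIntegrable
    have i2 := ((hχ.pow 2).intervalIntegrable (μ := volume) 0 L).const_mul (t ^ 2)
    have i3 := ((hc'.pow 2).intervalIntegrable (μ := volume) 0 L).const_mul (s ^ 2)
    simp only [Pi.pow_apply] at i2 i3
    have i0 : IntervalIntegrable (fun x => u x ^ 2) volume 0 L :=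
      (hu.continuousOn.pow 2).intervalIntegrable
    rw [hW, hc₁, hc₂, ← intervalIntegral.integral_const_mul (t ^ 2),
      ← intervalIntegral.integral_const_mul (s ^ 2), ← intervalIntegral.integral_add i1 i2,
      ← intervalIntegral.integral_add (i1.add i2) i3, ← intervalIntegral.integral_const_mul]
    refine intervalIntegral.integral_mono_on hL.le i0 (((i1.add i2).add i3).const_mul 3)
      fun x _ => ?_
    rw [huv]
    nlinarith [sq_nonneg (v x - t * χ x), sq_nonneg (v x - s * φ' x),
      sq_nonneg (t * χ x - s * φ' x)]
  have hu3 : ∫ x in (0 : ℝ)..L, u x ^ 2 ≤ C₁ * W + C₂ * t ^ 2 := by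
    refine hu2.trans ?_
    have := mul_le_mul_of_nonneg_right hs2 hc₂0
    rw [hC₁, hC₂]
    linarith
  set δ := min (l / C₁) (m / (C₂ + 1)) with hδ
  have hδ0 : 0 < δ := lt_min (by positivity) (by positivity)
  have hδ1 : δ * C₁ ≤ l := by
    rw [← le_div_iff₀ hC₁0]
    exact min_le_left _ _
  have hδ2 : δ * (C₂ + 1) ≤ m := by
    rw [← le_div_iff₀ (by positivity)]
    exact min_le_right _ _
  calc δ * ∫ x in (0 : ℝ)..L, u x ^ 2 ≤ δ * (C₁ * W + C₂ * t ^ 2) := by gcongr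
    _ = δ * C₁ * W + δ * C₂ * t ^ 2 := by ring
    _ ≤ l * W + m * t ^ 2 := by
      gcongr
      linarith
    _ ≤ _ := hform

end

end DnoidalProfile

/-! ### Reduction to real functions -/

lemma map_mul_ofReal (ℓ : ℂ →L[ℝ] ℝ) (z : ℂ) (r : ℝ) : ℓ (z * (r : ℂ)) = ℓ z * r := by
  rw [mul_comm, ← Complex.real_smul, map_smul, smul_eq_mul, mul_comm]

/-- Every real component of a function in `H¹_per` has an absolutely continuous representative. -/
lemma IsH1Per.exists_isH1On {L : ℝ} (hL : 0 < L) {f f' : ℝ → ℂ} (hf : IsH1Per L f f')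
    (ℓ : ℂ →L[ℝ] ℝ) :
    ∃ u : ℝ → ℝ, IsH1On 0 L u (fun x => ℓ (f' x)) ∧ u L = u 0 ∧
      ∀ᵐ x ∂volume.restrict (Set.Ioc 0 L), ℓ (f x) = u x := by
  refine exists_isH1On_of_weak_deriv hL (ℓ.comp_memLp' hf.memLp) (ℓ.comp_memLp' hf.memLp_deriv)
    fun θ hθ hθL => ?_
  have hint : ∀ {g : ℝ → ℂ}, MemLp g 2 (volume.restrict (Set.Ioc 0 L)) →
      IntervalIntegrable g volume 0 L := fun hg =>
    (intervalIntegrable_iff_integrableOn_Ioc_of_le hL.le).2 (hg.integrable one_le_two)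
  have hθd : ∀ x, HasDerivAt θ (deriv θ x) x := fun x =>
    (hθ.differentiable (by simp)).differentiableAt.hasDerivAt
  have hθc : Continuous (deriv θ) := hθ.continuous_deriv (by simp)
  have hd : deriv (fun x => (θ x : ℂ)) = fun x => ((deriv θ x : ℝ) : ℂ) :=
    funext fun x => (hθd x).ofReal_comp.deriv
  have h1 := hf.weak_deriv (fun x => (θ x : ℂ)) (Complex.ofRealCLM.contDiff.comp hθ) fun x => by
    simp only [hθL x]
  rw [hd] at h1
  have i1 : IntervalIntegrable (fun x => f x * ((deriv θ x : ℝ) : ℂ)) volume 0 L :=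
    (hint hf.memLp).mul_continuousOn (Complex.continuous_ofReal.comp hθc).continuousOn
  have i2 : IntervalIntegrable (fun x => f' x * (θ x : ℂ)) volume 0 L :=
    (hint hf.memLp_deriv).mul_continuousOn
      (Complex.continuous_ofReal.comp hθ.continuous).continuousOn
  have h2 := ℓ.intervalIntegral_comp_comm i1
  have h3 := ℓ.intervalIntegral_comp_comm i2
  simp only [map_mul_ofReal] at h2 h3
  rw [h2, h1, map_neg, h3]

lemma IsH1Per.integral_mul_eq_zero {L : ℝ} (hL : 0 < L) {f f' : ℝ → ℂ} (hf : IsH1Per L f f')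
    (ℓ : ℂ →L[ℝ] ℝ) {u w : ℝ → ℝ} (hw : Continuous w)
    (hu : ∀ᵐ x ∂volume.restrict (Set.Ioc 0 L), ℓ (f x) = u x)
    (h : innerPer L f (fun x => (w x : ℂ)) = 0) : ∫ x in (0 : ℝ)..L, u x * w x = 0 := by
  have hint : IntervalIntegrable f volume 0 L :=
    (intervalIntegrable_iff_integrableOn_Ioc_of_le hL.le).2 (hf.memLp.integrable one_le_two)
  have i1 : IntervalIntegrable (fun x => f x * (w x : ℂ)) volume 0 L :=
    hint.mul_continuousOn (Complex.continuous_ofReal.comp hw).continuousOn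
  have h2 := ℓ.intervalIntegral_comp_comm i1
  simp only [innerPer, Complex.conj_ofReal] at h
  rw [h, map_zero] at h2
  simp only [map_mul_ofReal] at h2
  refine Eq.trans ?_ h2
  refine intervalIntegral.integral_congr_ae ?_
  rw [Set.uIoc_of_le hL.le]
  exact ((ae_restrict_iff' measurableSet_Ioc).1 hu).mono fun x hx hxm => by rw [hx hxm]

/-- The quadratic form of a complex function with a real potential is the sum of those of its real
and imaginary parts. -/
lemma integral_form_eq_add {L : ℝ} (hL : 0 < L) {f f' : ℝ → ℂ} {V u₁ u₂ : ℝ → ℝ}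
    (hV : Continuous V) (h₁ : IsH1On 0 L u₁ fun x => (f' x).re)
    (h₂ : IsH1On 0 L u₂ fun x => (f' x).im)
    (hu₁ : ∀ᵐ x ∂volume.restrict (Set.Ioc 0 L), (f x).re = u₁ x)
    (hu₂ : ∀ᵐ x ∂volume.restrict (Set.Ioc 0 L), (f x).im = u₂ x) :
    ∫ x in (0 : ℝ)..L, (‖f' x‖ ^ 2 + V x * ‖f x‖ ^ 2) =
      (∫ x in (0 : ℝ)..L, ((f' x).re ^ 2 + V x * u₁ x ^ 2)) +
        ∫ x in (0 : ℝ)..L, ((f' x).im ^ 2 + V x * u₂ x ^ 2) := by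
  rw [← intervalIntegral.integral_add (h₁.form_integrable hV) (h₂.form_integrable hV)]
  refine intervalIntegral.integral_congr_ae ?_
  rw [Set.uIoc_of_le hL.le]
  refine (ae_restrict_iff' measurableSet_Ioc).1 ?_
  filter_upwards [hu₁, hu₂] with x h3 h4
  rw [Complex.sq_norm, Complex.sq_norm, Complex.normSq_apply, Complex.normSq_apply, h3, h4]
  ring

lemma normSqPer_eq_add {L : ℝ} (hL : 0 < L) {f : ℝ → ℂ} {u₁ u₂ g₁ g₂ : ℝ → ℝ}
    (h₁ : IsH1On 0 L u₁ g₁) (h₂ : IsH1On 0 L u₂ g₂)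
    (hu₁ : ∀ᵐ x ∂volume.restrict (Set.Ioc 0 L), (f x).re = u₁ x)
    (hu₂ : ∀ᵐ x ∂volume.restrict (Set.Ioc 0 L), (f x).im = u₂ x) :
    normSqPer L f = (∫ x in (0 : ℝ)..L, u₁ x ^ 2) + ∫ x in (0 : ℝ)..L, u₂ x ^ 2 := by
  have i1 : IntervalIntegrable (fun x => u₁ x ^ 2) volume 0 L :=
    (h₁.continuousOn.pow 2).intervalIntegrable
  have i2 : IntervalIntegrable (fun x => u₂ x ^ 2) volume 0 L :=
    (h₂.continuousOn.pow 2).intervalIntegrable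
  rw [normSqPer, ← intervalIntegral.integral_add i1 i2]
  refine intervalIntegral.integral_congr_ae ?_
  rw [Set.uIoc_of_le hL.le]
  refine (ae_restrict_iff' measurableSet_Ioc).1 ?_
  filter_upwards [hu₁, hu₂] with x h3 h4
  rw [Complex.sq_norm, Complex.normSq_apply, h3, h4]
  ring

lemma isH1Per_ofReal {L : ℝ} {u g : ℝ → ℝ} (hu : ∀ x, HasDerivAt u (g x) x) (hg : Continuous g)
    (hper : Function.Periodic u L) : IsH1Per L (fun x => (u x : ℂ)) (fun x => (g x : ℂ)) := by
  have hmem : ∀ {w : ℝ → ℝ}, Continuous w →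
      MemLp (fun x => (w x : ℂ)) 2 (volume.restrict (Set.Ioc 0 L)) := fun {w} hw => by
    have hc : Continuous fun x => (w x : ℂ) := Complex.continuous_ofReal.comp hw
    obtain ⟨C, hC⟩ := (isCompact_Icc (a := 0) (b := L)).exists_bound_of_continuousOn
      hc.continuousOn
    exact MemLp.of_bound hc.aestronglyMeasurable C ((ae_restrict_iff' measurableSet_Ioc).2
      (Filter.Eventually.of_forall fun x hx => hC x (Set.Ioc_subset_Icc_self hx)))
  have huc : Continuous u := continuous_iff_continuousAt.2 fun x => (hu x).continuousAt
  refine ⟨fun x => by simp only [hper x], hmem huc, hmem hg, fun θ hθ hθL => ?_⟩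
  have hθd : ∀ x, HasDerivAt θ (deriv θ x) x := fun x =>
    (hθ.differentiable (by simp)).differentiableAt.hasDerivAt
  have hθc : Continuous (deriv θ) := hθ.continuous_deriv (by simp)
  rw [intervalIntegral.integral_mul_deriv_eq_deriv_mul (fun x _ => (hu x).ofReal_comp)
    (fun x _ => hθd x) ((Complex.continuous_ofReal.comp hg).intervalIntegrable _ _)
    (hθc.intervalIntegrable _ _)]
  have h1 : u L = u 0 := by simpa using hper 0
  have h2 : θ L = θ 0 := by simpa using hθL 0
  rw [h1, h2, sub_self, zero_sub]

lemma innerPer_ofReal (L : ℝ) (u w : ℝ → ℝ) :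
    innerPer L (fun x => (u x : ℂ)) (fun x => (w x : ℂ)) =
      ((∫ x in (0 : ℝ)..L, u x * w x : ℝ) : ℂ) := by
  rw [innerPer, ← intervalIntegral.integral_ofReal]
  simp

/-- A nonzero periodic real function of class `C¹` has a multiple of norm one in `H¹_per`. -/
lemma exists_normalized {L : ℝ} (hL : 0 < L) {u g : ℝ → ℝ} (hu : ∀ x, HasDerivAt u (g x) x)
    (hg : Continuous g) (hper : Function.Periodic u L) (hne : ∃ x ∈ Set.Icc 0 L, u x ≠ 0) :
    ∃ r : ℝ, IsH1Per L (fun x => ((r * u x : ℝ) : ℂ)) (fun x => ((r * g x : ℝ) : ℂ)) ∧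
      normSqPer L (fun x => ((r * u x : ℝ) : ℂ)) = 1 := by
  have huc : Continuous u := continuous_iff_continuousAt.2 fun x => (hu x).continuousAt
  have hpos : 0 < ∫ x in (0 : ℝ)..L, u x ^ 2 := by
    obtain ⟨x, hx, hux⟩ := hne
    exact intervalIntegral.integral_pos hL (by fun_prop) (fun x _ => sq_nonneg _)
      ⟨x, hx, by positivity⟩
  refine ⟨(√(∫ x in (0 : ℝ)..L, u x ^ 2))⁻¹, isH1Per_ofReal (fun x => (hu x).const_mul _)
    (by fun_prop) fun x => by rw [hper x], ?_⟩
  simp only [normSqPer, Complex.norm_real, Real.norm_eq_abs, sq_abs, mul_pow, inv_pow]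
  rw [intervalIntegral.integral_const_mul, Real.sq_sqrt hpos.le, inv_mul_cancel₀ hpos.ne']

end Zakharov

open Zakharov in
theorem mainTheorem5 (L c ν : ℝ) (hL : 0 < L) (hc : 0 < 1 - c ^ 2)
    (hν : 2 * Real.pi ^ 2 / L ^ 2 < ν) :
    IsGLB (Zakharov.valuesA L c ν) 0 ∧
      ∃ a : ℝ, 0 < a ∧ IsGLB (Zakharov.valuesB L c ν) a := by
  obtain ⟨p, q, φ', P⟩ := exists_dnoidalProfile_phi hL hc hν
  set φ := phi L c ν with hφ
  set α := 1 - c ^ 2 with hα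
  have hφc := P.continuous
  have hφc' := P.continuous'
  have hV : Continuous fun x => ν - 3 * φ x ^ 2 / α := P.continuous_potential
  have hform : ∀ f f' : ℝ → ℂ, formL3 L c ν f f' =
      ∫ x in (0 : ℝ)..L, (‖f' x‖ ^ 2 + (ν - 3 * φ x ^ 2 / α) * ‖f x‖ ^ 2) := fun f f' => by
    refine intervalIntegral.integral_congr fun x _ => ?_
    simp only [psi_eq]
    ring
  have hdψ : deriv (fun y => (phi L c ν y : ℂ) * (psi L c ν y : ℂ)) =
      fun x => ((-3 / α * (φ' x * φ x ^ 2) : ℝ) : ℂ) := by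
    have e : (fun y => (phi L c ν y : ℂ) * (psi L c ν y : ℂ)) =
        fun y => ((-(φ y ^ 3 / α) : ℝ) : ℂ) := funext fun y => by
      rw [psi_eq, ← Complex.ofReal_mul]
      congr 1
      ring
    have hd : ∀ x, HasDerivAt (fun y => -(φ y ^ 3 / α)) (-3 / α * (φ' x * φ x ^ 2)) x :=
      fun x => ((((P.hasDerivAt x).pow 3).div_const α).neg.congr_deriv (by
        simp only [Nat.add_one_sub_one, Nat.cast_ofNat]
        ring))
    rw [e]
    exact funext fun x => (hd x).ofReal_comp.deriv
  have hκc : Continuous fun x => -3 / α * (φ' x * φ x ^ 2) := by fun_prop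
  have hzero : (0 : ℝ) ∈ valuesA L c ν := by
    have hne := (P.deriv_neg (L / 4) (by linarith) (by linarith)).ne
    obtain ⟨r, h1, h2⟩ := exists_normalized hL P.hasDerivAt' P.continuous_deriv_deriv
      P.deriv_periodic ⟨L / 4, ⟨by linarith, by linarith⟩, hne⟩
    refine ⟨_, _, h1, h2, ?_, ?_⟩
    · have e : ∀ x, r * φ' x * φ x = r * (φ' x * φ x ^ 1) := fun x => by ring
      change innerPer L _ (fun x => (φ x : ℂ)) = 0
      rw [innerPer_ofReal]
      simp_rw [e]
      rw [intervalIntegral.integral_const_mul, P.integral_deriv_mul_pow, mul_zero,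
        Complex.ofReal_zero]
    · have e : ∀ x, (r * (ν * φ x - φ x ^ 3 / α)) ^ 2 +
          (ν - 3 * φ x ^ 2 / α) * (r * φ' x) ^ 2 = r ^ 2 * ((ν * φ x - φ x ^ 3 / α) ^ 2 +
          (ν - 3 * φ x ^ 2 / α) * φ' x ^ 2) := fun x => by ring
      rw [hform]
      simp only [Complex.norm_real, Real.norm_eq_abs, sq_abs, e]
      rw [intervalIntegral.integral_const_mul, P.integral_form_deriv_eq_zero, mul_zero]
  have hnonneg : ∀ r ∈ valuesA L c ν, 0 ≤ r := by
    rintro r ⟨f, f', hf, -, horth, rfl⟩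
    obtain ⟨u₁, h₁, hL₁, hu₁⟩ := hf.exists_isH1On hL Complex.reCLM
    obtain ⟨u₂, h₂, hL₂, hu₂⟩ := hf.exists_isH1On hL Complex.imCLM
    rw [hform, integral_form_eq_add hL hV h₁ h₂ hu₁ hu₂]
    exact add_nonneg
      (P.form_nonneg h₁ hL₁ (hf.integral_mul_eq_zero hL Complex.reCLM hφc hu₁ horth))
      (P.form_nonneg h₂ hL₂ (hf.integral_mul_eq_zero hL Complex.imCLM hφc hu₂ horth))
  refine ⟨⟨hnonneg, fun b hb => hb hzero⟩, ?_⟩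
  obtain ⟨δ, hδ, hco⟩ := P.exists_coercive
  have hlower : ∀ r ∈ valuesB L c ν, δ ≤ r := by
    rintro r ⟨f, f', hf, hnorm, horth, horth', rfl⟩
    rw [hdψ] at horth'
    obtain ⟨u₁, h₁, hL₁, hu₁⟩ := hf.exists_isH1On hL Complex.reCLM
    obtain ⟨u₂, h₂, hL₂, hu₂⟩ := hf.exists_isH1On hL Complex.imCLM
    have key : ∀ u : ℝ → ℝ, ∫ x in (0 : ℝ)..L, u x * (-3 / α * (φ' x * φ x ^ 2)) = 0 →
        ∫ x in (0 : ℝ)..L, u x * (φ' x * φ x ^ 2) = 0 := fun u hu => by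
      have e : ∀ x, u x * (-3 / α * (φ' x * φ x ^ 2)) = -3 / α * (u x * (φ' x * φ x ^ 2)) :=
        fun x => by ring
      simp_rw [e] at hu
      rw [intervalIntegral.integral_const_mul] at hu
      exact (mul_eq_zero.1 hu).resolve_left (div_ne_zero (by norm_num) hc.ne')
    have c₁ := hco _ _ h₁ hL₁ (hf.integral_mul_eq_zero hL Complex.reCLM hφc hu₁ horth)
      (key _ (hf.integral_mul_eq_zero hL Complex.reCLM hκc hu₁ horth'))
    have c₂ := hco _ _ h₂ hL₂ (hf.integral_mul_eq_zero hL Complex.imCLM hφc hu₂ horth)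
      (key _ (hf.integral_mul_eq_zero hL Complex.imCLM hκc hu₂ horth'))
    rw [normSqPer_eq_add hL h₁ h₂ hu₁ hu₂] at hnorm
    rw [hform, integral_form_eq_add hL hV h₁ h₂ hu₁ hu₂]
    calc δ = δ * 1 := (mul_one δ).symm
      _ = δ * (∫ x in (0 : ℝ)..L, u₁ x ^ 2) + δ * ∫ x in (0 : ℝ)..L, u₂ x ^ 2 := by
        rw [← hnorm, mul_add]
      _ ≤ _ := add_le_add c₁ c₂
  have hnonempty : (valuesB L c ν).Nonempty := by
    -- Any polynomial in `φ` is orthogonal to `φ² φ'`; the constant `m` makes `φ² - m`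
    -- orthogonal to `φ` as well.
    have hφ1 : 0 < ∫ x in (0 : ℝ)..L, φ x :=
      intervalIntegral.integral_pos hL hφc.continuousOn (fun x _ => (P.pos x).le)
        ⟨0, ⟨le_rfl, hL.le⟩, P.pos 0⟩
    set m := (∫ x in (0 : ℝ)..L, φ x ^ 3) / ∫ x in (0 : ℝ)..L, φ x with hm
    have hne : ∃ x ∈ Set.Icc 0 L, φ x ^ 2 - m ≠ 0 := by
      by_contra! h
      have h1 := h 0 ⟨le_rfl, hL.le⟩
      have h2 := h (L / 2) ⟨by linarith, by linarith⟩
      rw [P.apply_zero] at h1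
      rw [P.apply_half] at h2
      have := pow_lt_pow_left₀ P.q_lt_p P.q_pos.le two_ne_zero
      linarith
    obtain ⟨r, h1, h2⟩ := exists_normalized hL (P.hasDerivAt_sq m)
      (by fun_prop) (fun x => by simp only [P.periodic x]) hne
    refine ⟨_, _, _, h1, h2, ?_, ?_, rfl⟩
    · have e : ∀ x, r * (φ x ^ 2 - m) * φ x = r * (φ x ^ 3 - m * φ x) := fun x => by ring
      change innerPer L _ (fun x => (φ x : ℂ)) = 0
      rw [innerPer_ofReal]
      simp_rw [e]
      have i3 : IntervalIntegrable (fun x => φ x ^ 3) volume 0 L :=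
        (hφc.pow 3).intervalIntegrable _ _
      have i1 : IntervalIntegrable φ volume 0 L := hφc.intervalIntegrable _ _
      rw [intervalIntegral.integral_const_mul, intervalIntegral.integral_sub i3 (i1.const_mul m),
        intervalIntegral.integral_const_mul, hm, div_mul_cancel₀ _ hφ1.ne', sub_self, mul_zero,
        Complex.ofReal_zero]
    · have e : ∀ x, r * (φ x ^ 2 - m) * (-3 / α * (φ' x * φ x ^ 2)) =
          r * (-3 / α) * (φ' x * φ x ^ 4 - m * (φ' x * φ x ^ 2)) := fun x => by ring
      rw [hdψ, innerPer_ofReal]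
      simp_rw [e]
      have i4 : IntervalIntegrable (fun x => φ' x * φ x ^ 4) volume 0 L :=
        (hφc'.mul (hφc.pow 4)).intervalIntegrable _ _
      have i2 : IntervalIntegrable (fun x => φ' x * φ x ^ 2) volume 0 L :=
        (hφc'.mul (hφc.pow 2)).intervalIntegrable _ _
      rw [intervalIntegral.integral_const_mul, intervalIntegral.integral_sub i4 (i2.const_mul m),
        intervalIntegral.integral_const_mul, P.integral_deriv_mul_pow, P.integral_deriv_mul_pow,
        mul_zero, sub_self, mul_zero, Complex.ofReal_zero]
  refine ⟨sInf (valuesB L c ν), lt_of_lt_of_le hδ (le_csInf hnonempty hlower), ?_⟩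
  exact isGLB_csInf hnonempty ⟨δ, hlower⟩
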